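/- Fix $\alpha>0$, $x_{\max}>0$, $\lambda\in\mathbb{R}$ and $\sigma\ge 0$. Call a sequence of random $m\times n$ matrices $\mathbf{A}_n=(A_{ij})$ (with $m=m_n$) of \emph{standard type} if its entries are independent and identically distributed with $\mathbb{E}[A_{ij}]=0$, $\mathbb{E}[A_{ij}^2]=1$ and $\mathbb{E}[A_{ij}^6]\le K<\infty$ for some $K$ independent of $m,n$. For each $n$ let $x_0=x_0^{(n)}\in\mathbb{R}^n$ be a deterministic vector with $|x_{0,i}|\le x_{\max}$ for all $i$. For an $m\times n$ matrix $A$ and a noise vector $z\in\mathbb{R}^m$ put $y=Ax_0+z$ and $$L(A)=\frac1n\,\min_{x\in[-x_{\max},x_{\max}]^n}\Big\{\tfrac12\|y-Ax\|_2^2+\lambda\|x\|_1\Big\}.$$ Let $\mathbf{A}_n$ and $\mathbf{B}_n$ be two sequences of $m\times n$ random matrices of standard type, and let the noise $z$ have i.i.d. $\mathsf{N}(0,\sigma^2)$ entries and be independent of the matrix. Then $L(n^{-1/2}\mathbf{A}_n)$ and $L(n^{-1/2}\mathbf{B}_n)$ are integrable, and $$\lim_{n\to\infty}\Big\{\mathbb{E}\big[L(n^{-1/2}\mathbf{A}_n)\big]-\mathbb{E}\big[L(n^{-1/2}\mathbf{B}_n)\big]\Big\}=0$$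 as $m,n\to\infty$ along any sequence of dimensions with $m/n\to\alpha$ (in particular with $m=\alpha n$), the expectations being over both the matrix and the noise. -/

import Mathlib

open MeasureTheory ProbabilityTheory Filter Topology
open scoped NNReal Matrix

/-- The LASSO objective `½ ‖y - A x‖₂² + lam ‖x‖₁`. -/
noncomputable def lassoObjective {m n : ℕ} (lam : ℝ) (A : Matrix (Fin m) (Fin n) ℝ)
    (y : Fin m → ℝ) (x : Fin n → ℝ) : ℝ :=
  1 / 2 * ∑ i, (y i - (A *ᵥ x) i) ^ 2 + lam * ∑ j, |x j|

/-- The box `[-xmax, xmax]ⁿ`. -/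
def lassoBox (n : ℕ) (xmax : ℝ) : Set (Fin n → ℝ) :=
  {x | ∀ j, x j ∈ Set.Icc (-xmax) xmax}

/-- The minimum of the LASSO objective over the box `[-xmax, xmax]ⁿ`
(attained, see `lassoMin_isLeast`). -/
noncomputable def lassoMin {m n : ℕ} (xmax lam : ℝ) (A : Matrix (Fin m) (Fin n) ℝ)
    (y : Fin m → ℝ) : ℝ :=
  sInf (lassoObjective lam A y '' lassoBox n xmax)

/-- The infimum that defines `lassoMin` is a minimum. -/
theorem lassoMin_isLeast {m n : ℕ} {xmax : ℝ} (hx : 0 ≤ xmax) (lam : ℝ)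
    (A : Matrix (Fin m) (Fin n) ℝ) (y : Fin m → ℝ) :
    IsLeast (lassoObjective lam A y '' lassoBox n xmax) (lassoMin xmax lam A y) := by
  have hbox : lassoBox n xmax = Set.pi Set.univ (fun _ => Set.Icc (-xmax) xmax) := by
    ext x; simp only [lassoBox, Set.mem_setOf_eq, Set.mem_pi, Set.mem_univ, true_imp_iff]
  have hc : IsCompact (lassoBox n xmax) := by
    rw [hbox]; exact isCompact_univ_pi (fun _ => isCompact_Icc)
  have hf : Continuous (lassoObjective lam A y) := by
    unfold lassoObjective Matrix.mulVec dotProduct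
    fun_prop
  have hne : (lassoBox n xmax).Nonempty := ⟨0, fun j => by simpa using hx⟩
  exact (hc.image hf).isLeast_sInf (hne.image _)

/-- The normalized LASSO cost `L(A) = (1/n) min_x {½ ‖y - A x‖₂² + lam ‖x‖₁}` over the box
`[-xmax, xmax]ⁿ`, where the measurements `y = A x₀ + z` are produced by the same matrix `A`. -/
noncomputable def lassoCost {m n : ℕ} (xmax lam : ℝ) (x₀ : Fin n → ℝ) (z : Fin m → ℝ)
    (A : Matrix (Fin m) (Fin n) ℝ) : ℝ :=
  1 / (n : ℝ) * lassoMin xmax lam A (A *ᵥ x₀ + z)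

/-- A sequence of random matrices `A k`, of dimensions `m k × n k`, is of standard type: for each
`k` the entries are i.i.d., centered, of unit variance, and their sixth moments are bounded by a
constant which does not depend on `k`. -/
structure IsStandardType {Ω : ℕ → Type*} [∀ k, MeasurableSpace (Ω k)]
    (P : ∀ k, Measure (Ω k)) {m n : ℕ → ℕ}
    (A : ∀ k, Ω k → Matrix (Fin (m k)) (Fin (n k)) ℝ) : Prop where
  measurable : ∀ k i j, Measurable (fun ω => A k ω i j)
  indep : ∀ k, iIndepFun (fun (p : Fin (m k) × Fin (n k)) ω => A k ω p.1 p.2) (P k)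
  identDistrib : ∀ k i j i' j',
    IdentDistrib (fun ω => A k ω i j) (fun ω => A k ω i' j') (P k) (P k)
  mean : ∀ k i j, ∫ ω, A k ω i j ∂(P k) = 0
  variance : ∀ k i j, ∫ ω, (A k ω i j) ^ 2 ∂(P k) = 1
  sixth_moment : ∃ K : ℝ, ∀ k i j,
    Integrable (fun ω => (A k ω i j) ^ 6) (P k) ∧ ∫ ω, (A k ω i j) ^ 6 ∂(P k) ≤ K

/-- The random vectors `z k` have i.i.d. `N(0, σ²)` entries and are independent of the
random matrices `A k`. -/
structure IsGaussianNoise {Ω : ℕ → Type*} [∀ k, MeasurableSpace (Ω k)]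
    (P : ∀ k, Measure (Ω k)) {m n : ℕ → ℕ} (σ : ℝ≥0)
    (A : ∀ k, Ω k → Matrix (Fin (m k)) (Fin (n k)) ℝ)
    (z : ∀ k, Ω k → Fin (m k) → ℝ) : Prop where
  measurable : ∀ k i, Measurable (fun ω => z k ω i)
  law : ∀ k i, HasLaw (fun ω => z k ω i) (gaussianReal 0 (σ ^ 2)) (P k)
  indep : ∀ k, iIndepFun (fun i ω => z k ω i) (P k)
  indep_matrix : ∀ k, IndepFun
    (fun ω (p : Fin (m k) × Fin (n k)) => A k ω p.1 p.2) (z k) (P k)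

/-- The weighted mean of `f` with weights `w`. -/
noncomputable def weightedMean {S : Type*} [Fintype S] (w f : S → ℝ) : ℝ :=
  (∑ s, w s * f s) / ∑ s, w s

section WeightedMean

variable {S : Type*} [Fintype S]

theorem weightedMean_mono {w f g : S → ℝ} (hw : ∀ s, 0 ≤ w s) (h : ∀ s, f s ≤ g s) :
    weightedMean w f ≤ weightedMean w g := by
  unfold weightedMean
  gcongr with s
  · exact Finset.sum_nonneg fun s _ => hw s
  · exact hw s
  · exact h s

theorem weightedMean_nonneg {w f : S → ℝ} (hw : ∀ s, 0 ≤ w s) (h : ∀ s, 0 ≤ f s) :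
    0 ≤ weightedMean w f :=
  div_nonneg (Finset.sum_nonneg fun s _ => mul_nonneg (hw s) (h s))
    (Finset.sum_nonneg fun s _ => hw s)

theorem weightedMean_add (w f g : S → ℝ) :
    weightedMean w (fun s => f s + g s) = weightedMean w f + weightedMean w g := by
  simp only [weightedMean, mul_add, Finset.sum_add_distrib, add_div]

theorem weightedMean_const_mul (w f : S → ℝ) (c : ℝ) :
    weightedMean w (fun s => c * f s) = c * weightedMean w f := by
  simp only [weightedMean, ← mul_div_assoc, Finset.mul_sum]
  congr 1
  exact Finset.sum_congr rfl fun s _ => by ring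

theorem weightedMean_const {w : S → ℝ} (hw : 0 < ∑ s, w s) (c : ℝ) :
    weightedMean w (fun _ => c) = c := by
  simp only [weightedMean, ← Finset.sum_mul]
  field_simp

theorem abs_weightedMean_le {w f : S → ℝ} (hw : ∀ s, 0 ≤ w s) :
    |weightedMean w f| ≤ weightedMean w (fun s => |f s|) := by
  unfold weightedMean
  rw [abs_div, abs_of_nonneg (Finset.sum_nonneg fun s _ => hw s)]
  gcongr
  · exact Finset.sum_nonneg fun s _ => hw s
  · refine (Finset.abs_sum_le_sum_abs _ _).trans (le_of_eq ?_)
    exact Finset.sum_congr rfl fun s _ => by rw [abs_mul, abs_of_nonneg (hw s)]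

/-- Chebyshev's sum inequality with weights. -/
theorem sum_mul_sum_le_of_monovary {w f g : S → ℝ} (hw : ∀ s, 0 ≤ w s)
    (h : ∀ s t, 0 ≤ (f s - f t) * (g s - g t)) :
    (∑ s, w s * f s) * ∑ s, w s * g s ≤ (∑ s, w s * (f s * g s)) * ∑ s, w s := by
  have h1 : 0 ≤ ∑ s, ∑ t, w s * w t * ((f s - f t) * (g s - g t)) :=
    Finset.sum_nonneg fun s _ => Finset.sum_nonneg fun t _ =>
      mul_nonneg (mul_nonneg (hw s) (hw t)) (h s t)
  have h2 : ∑ s, ∑ t, w s * w t * ((f s - f t) * (g s - g t)) =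
      ((∑ s, w s * (f s * g s)) * ∑ s, w s) + ((∑ s, w s) * ∑ s, w s * (f s * g s))
        - ((∑ s, w s * f s) * ∑ s, w s * g s) - ((∑ s, w s * g s) * ∑ s, w s * f s) := by
    simp only [Finset.sum_mul_sum, ← Finset.sum_add_distrib, ← Finset.sum_sub_distrib]
    exact Finset.sum_congr rfl fun s _ => Finset.sum_congr rfl fun t _ => by ring
  nlinarith [h1, h2]

theorem weightedMean_mul_weightedMean_le {w f g : S → ℝ} (hw : ∀ s, 0 ≤ w s)
    (hw' : 0 < ∑ s, w s) (h : ∀ s t, 0 ≤ (f s - f t) * (g s - g t)) :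
    weightedMean w f * weightedMean w g ≤ weightedMean w (fun s => f s * g s) := by
  unfold weightedMean
  rw [div_mul_div_comm, div_le_div_iff₀ (mul_pos hw' hw') hw', ← mul_assoc]
  exact mul_le_mul_of_nonneg_right (sum_mul_sum_le_of_monovary hw h) hw'.le

/-- Reweighting by a factor that is oppositely ordered to `f` decreases the mean of `f`. -/
theorem weightedMean_mul_le_of_antivary [Nonempty S] {w e f : S → ℝ} (hw : ∀ s, 0 < w s)
    (he : ∀ s, 0 < e s) (h : ∀ s t, (e s - e t) * (f s - f t) ≤ 0) :
    weightedMean (fun s => w s * e s) f ≤ weightedMean w f := by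
  unfold weightedMean
  rw [div_le_div_iff₀ (Finset.sum_pos (fun s _ => mul_pos (hw s) (he s)) Finset.univ_nonempty)
    (Finset.sum_pos (fun s _ => hw s) Finset.univ_nonempty)]
  have := sum_mul_sum_le_of_monovary (w := w) (f := f) (g := fun s => - e s)
    (fun s => (hw s).le) (fun s t => by have := h s t; nlinarith)
  simp only [mul_neg, Finset.sum_neg_distrib, neg_mul, neg_le_neg_iff] at this
  have hs : ∑ s, w s * e s * f s = ∑ s, w s * (f s * e s) :=
    Finset.sum_congr rfl fun s _ => by ring
  rwa [hs]

/-- Derivative of a Gibbs mean. -/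
theorem hasDerivAt_weightedMean_exp [Nonempty S] {q q' f f' : S → ℝ → ℝ} {t : ℝ}
    (hq : ∀ s, HasDerivAt (q s) (q' s t) t) (hf : ∀ s, HasDerivAt (f s) (f' s t) t) :
    HasDerivAt (fun t => weightedMean (fun s => Real.exp (q s t)) (fun s => f s t))
      (weightedMean (fun s => Real.exp (q s t)) (fun s => f' s t)
        + weightedMean (fun s => Real.exp (q s t)) (fun s => f s t * q' s t)
        - weightedMean (fun s => Real.exp (q s t)) (fun s => f s t)
          * weightedMean (fun s => Real.exp (q s t)) (fun s => q' s t)) t := by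
  have hZ : 0 < ∑ s, Real.exp (q s t) :=
    Finset.sum_pos (fun s _ => Real.exp_pos _) Finset.univ_nonempty
  have h1 : HasDerivAt (fun t => ∑ s, Real.exp (q s t)) (∑ s, Real.exp (q s t) * q' s t) t :=
    HasDerivAt.fun_sum fun s _ => (hq s).exp
  have h2 : HasDerivAt (fun t => ∑ s, Real.exp (q s t) * f s t)
      (∑ s, (Real.exp (q s t) * q' s t * f s t + Real.exp (q s t) * f' s t)) t :=
    HasDerivAt.fun_sum fun s _ => (hq s).exp.mul (hf s)
  refine (h2.div h1 hZ.ne').congr_deriv ?_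
  unfold weightedMean
  have h3 : ∑ s, Real.exp (q s t) * (f s t * q' s t)
      = ∑ s, Real.exp (q s t) * q' s t * f s t :=
    Finset.sum_congr rfl fun s _ => by ring
  rw [Finset.sum_add_distrib, h3]
  field_simp
  ring

theorem hasDerivAt_log_sum_exp [Nonempty S] {q q' : S → ℝ → ℝ} {t : ℝ}
    (hq : ∀ s, HasDerivAt (q s) (q' s t) t) :
    HasDerivAt (fun t => Real.log (∑ s, Real.exp (q s t)))
      (weightedMean (fun s => Real.exp (q s t)) (fun s => q' s t)) t := by
  have hZ : 0 < ∑ s, Real.exp (q s t) :=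
    Finset.sum_pos (fun s _ => Real.exp_pos _) Finset.univ_nonempty
  exact (HasDerivAt.fun_sum fun s _ => (hq s).exp).log hZ.ne'

end WeightedMean

/-- Second-order Taylor expansion at `0` with a bound on the third derivative. -/
theorem abs_taylor_two_le {g g₁ g₂ g₃ : ℝ → ℝ} (h₁ : ∀ t, HasDerivAt g (g₁ t) t)
    (h₂ : ∀ t, HasDerivAt g₁ (g₂ t) t) (h₃ : ∀ t, HasDerivAt g₂ (g₃ t) t) {a M : ℝ}
    (hM : ∀ t, |t| ≤ |a| → |g₃ t| ≤ M) :
    |g a - (g 0 + g₁ 0 * a + g₂ 0 / 2 * a ^ 2)| ≤ M * |a| ^ 3 := by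
  have hM0 : 0 ≤ M := (abs_nonneg _).trans (hM 0 (by simp))
  set s : Set ℝ := Set.Icc (-|a|) |a|
  have hs : Convex ℝ s := convex_Icc _ _
  have h0 : (0 : ℝ) ∈ s := ⟨by simp, by simp⟩
  have ha : a ∈ s := ⟨neg_abs_le a, le_abs_self a⟩
  have key : ∀ (f f' : ℝ → ℝ) (C : ℝ), 0 ≤ C → (∀ t, HasDerivAt f (f' t) t) →
      (∀ t ∈ s, |f' t| ≤ C) → f 0 = 0 → ∀ t ∈ s, |f t| ≤ C * |a| := by
    intro f f' C hC hf hb hf0 t ht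
    have := hs.norm_image_sub_le_of_norm_hasDerivWithin_le
      (fun x _ => (hf x).hasDerivWithinAt) (C := C) hb h0 ht
    rw [hf0, sub_zero, sub_zero, Real.norm_eq_abs, Real.norm_eq_abs] at this
    exact this.trans (mul_le_mul_of_nonneg_left (abs_le.2 ht) hC)
  have k2 := key (fun t => g₂ t - g₂ 0) g₃ M hM0 (fun t => (h₃ t).sub_const _)
    (fun t ht => hM t (abs_le.2 ht)) (sub_self _)
  have k1 := key (fun t => g₁ t - (g₁ 0 + g₂ 0 * t)) (fun t => g₂ t - g₂ 0) (M * |a|)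
    (by positivity) (fun t => ((h₂ t).sub
      (((hasDerivAt_id t).const_mul (g₂ 0)).const_add (g₁ 0))).congr_deriv (by simp))
    k2 (by simp)
  have k0 := key (fun t => g t - (g 0 + g₁ 0 * t + g₂ 0 / 2 * t ^ 2))
    (fun t => g₁ t - (g₁ 0 + g₂ 0 * t)) (M * |a| * |a|)
    (by positivity) (fun t => by
      have e := (((hasDerivAt_id t).const_mul (g₁ 0)).const_add (g 0)).add
        (((hasDerivAt_id t).pow 2).const_mul (g₂ 0 / 2))
      exact ((h₁ t).sub e).congr_deriv (by simp; ring))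
    k1 (by simp) a ha
  calc _ ≤ M * |a| * |a| * |a| := k0
    _ = _ := by ring

theorem abs_third_cumulant_le {c p p2 p3 x y v u : ℝ} (hc : 0 ≤ c) (hp : 0 ≤ p) (hp2 : 0 ≤ p2)
    (hx : |x| ≤ p) (hy : |y| ≤ c) (hv : |v| ≤ c * p) (hu : |u| ≤ p3) (h23 : p2 * p ≤ p3)
    (h12 : p * p ≤ p2) :
    |0 + v - y * x + (2 * v + u - p2 * x) - ((y + p2 - x * x) * x + x * (y + p2 - x * x))|
      ≤ 6 * c * p + 6 * p3 := by
  have b1 : |y * x| ≤ c * p := by rw [abs_mul]; exact mul_le_mul hy hx (abs_nonneg _) hc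
  have b2 : |p2 * x| ≤ p3 := by
    rw [abs_mul, abs_of_nonneg hp2]
    exact (mul_le_mul_of_nonneg_left hx hp2).trans h23
  have b3 : |x * x * x| ≤ p3 := by
    rw [abs_mul, abs_mul]
    calc |x| * |x| * |x| ≤ p * p * p := by gcongr
      _ ≤ p2 * p := by gcongr
      _ ≤ p3 := h23
  rw [show 0 + v - y * x + (2 * v + u - p2 * x) - ((y + p2 - x * x) * x + x * (y + p2 - x * x))
    = 3 * v - 3 * (y * x) + u - 3 * (p2 * x) + 2 * (x * x * x) by ring]
  rw [abs_le] at hv hu b1 b2 b3 ⊢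
  constructor <;> linarith

section LogSumExp

variable {S : Type*} [Fintype S] [Nonempty S]

theorem abs_third_cumulant_weightedMean_le {w : S → ℝ} (hw : ∀ s, 0 < w s) {f h : S → ℝ} {c : ℝ}
    (hc : ∀ s, |h s| ≤ c) :
    |weightedMean w (fun _ => 0) + weightedMean w (fun s => h s * f s)
        - weightedMean w h * weightedMean w f
      + (weightedMean w (fun s => h s * f s + f s * h s)
        + weightedMean w (fun s => f s * f s * f s)
        - weightedMean w (fun s => f s * f s) * weightedMean w f)
      - ((weightedMean w h + weightedMean w (fun s => f s * f s)
          - weightedMean w f * weightedMean w f) * weightedMean w f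
        + weightedMean w f * (weightedMean w h + weightedMean w (fun s => f s * f s)
          - weightedMean w f * weightedMean w f))|
      ≤ 6 * c * weightedMean w (fun s => |f s|) + 6 * weightedMean w (fun s => |f s| ^ 3) := by
  have hw' : ∀ s, 0 ≤ w s := fun s => (hw s).le
  have hZ : 0 < ∑ s, w s := Finset.sum_pos (fun s _ => hw s) Finset.univ_nonempty
  have hc0 : 0 ≤ c := (abs_nonneg _).trans (hc (Classical.arbitrary S))
  have e3 : |weightedMean w fun s => h s * f s| ≤ c * weightedMean w fun s => |f s| := by
    rw [← weightedMean_const_mul]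
    refine (abs_weightedMean_le hw').trans (weightedMean_mono hw' fun s => ?_)
    rw [abs_mul]
    exact mul_le_mul_of_nonneg_right (hc s) (abs_nonneg _)
  have e4 : (weightedMean w fun s => h s * f s + f s * h s)
      = 2 * weightedMean w fun s => h s * f s := by
    rw [← weightedMean_const_mul]
    congr 1
    ext s
    ring
  have e5 : (weightedMean w fun s => f s * f s) = weightedMean w fun s => |f s| ^ 2 := by
    congr 1
    ext s
    rw [sq_abs, sq]
  rw [e4, e5, weightedMean_const hZ]
  refine abs_third_cumulant_le hc0 (weightedMean_nonneg hw' fun s => abs_nonneg _)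
    (weightedMean_nonneg hw' fun s => by positivity) (abs_weightedMean_le hw')
    ((abs_weightedMean_le hw').trans ((weightedMean_mono hw' hc).trans (weightedMean_const hZ c).le))
    e3 ?_ ?_ ?_
  · refine (abs_weightedMean_le hw').trans (weightedMean_mono hw' fun s => ?_)
    rw [abs_mul, abs_mul]
    exact le_of_eq (by ring)
  · refine (weightedMean_mul_weightedMean_le hw' hZ fun s s' => ?_).trans
      (weightedMean_mono hw' fun s => le_of_eq (by ring))
    have h1 := abs_nonneg (f s)
    have h2 := abs_nonneg (f s')
    nlinarith [mul_nonneg (add_nonneg h1 h2) (sq_nonneg (|f s| - |f s'|))]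
  · exact (weightedMean_mul_weightedMean_le hw' hZ fun s s' => mul_self_nonneg _).trans
      (weightedMean_mono hw' fun s => le_of_eq (by ring))

/-- The third derivative of `log ∑ exp q_s` for quadratic polynomials `q_s`. -/
theorem abs_taylor_two_log_sum_exp_le {q q' : S → ℝ → ℝ} {q'' : S → ℝ} {c : ℝ}
    (hq : ∀ s t, HasDerivAt (q s) (q' s t) t) (hq' : ∀ s t, HasDerivAt (q' s) (q'' s) t)
    (hc : ∀ s, |q'' s| ≤ c) :
    ∃ l₁ l₂ : ℝ, ∀ a M : ℝ,
      (∀ t, |t| ≤ |a| → 6 * c * weightedMean (fun s => Real.exp (q s t)) (fun s => |q' s t|)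
        + 6 * weightedMean (fun s => Real.exp (q s t)) (fun s => |q' s t| ^ 3) ≤ M) →
      |Real.log (∑ s, Real.exp (q s a)) -
        (Real.log (∑ s, Real.exp (q s 0)) + l₁ * a + l₂ * a ^ 2)| ≤ M * |a| ^ 3 := by
  have d1 : ∀ t, HasDerivAt (fun t => Real.log (∑ s, Real.exp (q s t)))
      (weightedMean (fun s => Real.exp (q s t)) fun s => q' s t) t :=
    fun t => hasDerivAt_log_sum_exp fun s => hq s t
  have d2 := fun t => hasDerivAt_weightedMean_exp (f' := fun s _ => q'' s) (fun s => hq s t)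
    fun s => hq' s t
  have d3a := fun t => hasDerivAt_weightedMean_exp (f := fun s _ => q'' s) (f' := fun _ _ => 0)
      (fun s => hq s t) fun s => hasDerivAt_const _ _
  have d3b := fun t => hasDerivAt_weightedMean_exp (f := fun s t => q' s t * q' s t)
      (f' := fun s t => q'' s * q' s t + q' s t * q'' s)
      (fun s => hq s t) fun s => (hq' s t).fun_mul (hq' s t)
  have d3 := fun t => ((d3a t).fun_add (d3b t)).fun_sub ((d2 t).fun_mul (d2 t))
  exact ⟨_, _, fun a M hM => abs_taylor_two_le d1 d2 d3 fun t ht =>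
    (abs_third_cumulant_weightedMean_le (fun s => Real.exp_pos _) hc).trans (hM t ht)⟩

end LogSumExp

/-- A probability measure on `ℝ` with mean zero, unit variance and sixth moment at most `K`. -/
structure IsStandardLaw (K : ℝ) (μ : Measure ℝ) : Prop where
  isProbabilityMeasure : IsProbabilityMeasure μ
  mean : ∫ a, a ∂μ = 0
  variance : ∫ a, a ^ 2 ∂μ = 1
  integrable_pow_six : Integrable (fun a => a ^ 6) μ
  integral_pow_six_le : ∫ a, a ^ 6 ∂μ ≤ K

theorem abs_pow_le_one_add_pow_six (a : ℝ) {p : ℕ} (hp : p ≤ 6) : |a| ^ p ≤ 1 + a ^ 6 := by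
  have h6 : a ^ 6 = |a| ^ 6 := (Even.pow_abs (by decide) a).symm
  rcases le_total |a| 1 with h | h
  · have := pow_le_one₀ (n := p) (abs_nonneg a) h
    have : 0 ≤ |a| ^ 6 := by positivity
    linarith
  · have := pow_le_pow_right₀ h hp
    linarith

namespace IsStandardLaw

variable {K : ℝ} {μ ν : Measure ℝ}

theorem integrable_abs_pow (hμ : IsStandardLaw K μ) {p : ℕ} (hp : p ≤ 6) :
    Integrable (fun a => |a| ^ p) μ := by
  have := hμ.isProbabilityMeasure
  refine Integrable.mono' ((integrable_const 1).add hμ.integrable_pow_six)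
    (by fun_prop) (Eventually.of_forall fun a => ?_)
  rw [Real.norm_eq_abs, abs_of_nonneg (by positivity)]
  exact abs_pow_le_one_add_pow_six a hp

theorem integrable_pow (hμ : IsStandardLaw K μ) {p : ℕ} (hp : p ≤ 6) :
    Integrable (fun a => a ^ p) μ := by
  refine (hμ.integrable_abs_pow hp).mono' (by fun_prop) (Eventually.of_forall fun a => ?_)
  rw [Real.norm_eq_abs, abs_pow]

theorem integral_abs_pow_le (hμ : IsStandardLaw K μ) {p : ℕ} (hp : p ≤ 6) :
    ∫ a, |a| ^ p ∂μ ≤ 1 + K := by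
  have := hμ.isProbabilityMeasure
  calc ∫ a, |a| ^ p ∂μ ≤ ∫ a, (1 + a ^ 6) ∂μ :=
        integral_mono (hμ.integrable_abs_pow hp) ((integrable_const 1).add hμ.integrable_pow_six)
          fun a => abs_pow_le_one_add_pow_six a hp
    _ ≤ 1 + K := by
        rw [integral_add (integrable_const _) hμ.integrable_pow_six]
        simpa using hμ.integral_pow_six_le

theorem nonneg (hμ : IsStandardLaw K μ) : 0 ≤ K :=
  (integral_nonneg fun a => by positivity).trans hμ.integral_pow_six_le

/-- A continuous function that is approximated by a quadratic polynomial up to an error of order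
three has an integral determined by the first two moments up to that error. -/
theorem abs_integral_sub_le_of_taylor (hμ : IsStandardLaw K μ) {h : ℝ → ℝ} (hh : Continuous h)
    {l₀ l₁ l₂ C C' : ℝ} (hC : 0 ≤ C) (hC' : 0 ≤ C')
    (ht : ∀ a, |h a - (l₀ + l₁ * a + l₂ * a ^ 2)| ≤ (C + C' * |a| ^ 3) * |a| ^ 3) :
    |∫ a, h a ∂μ - (l₀ + l₂)| ≤ C * (1 + K) + C' * K := by
  have := hμ.isProbabilityMeasure
  have i1 : Integrable (fun a => a) μ := by simpa using hμ.integrable_pow (p := 1) (by norm_num)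
  have i2 := hμ.integrable_pow (p := 2) (by norm_num)
  have i3 := hμ.integrable_abs_pow (p := 3) (by norm_num)
  have ip : Integrable (fun a => l₀ + l₁ * a + l₂ * a ^ 2) μ :=
    ((integrable_const _).add (i1.const_mul _)).add (i2.const_mul _)
  have ip' : ∫ a, (l₀ + l₁ * a + l₂ * a ^ 2) ∂μ = l₀ + l₂ := by
    have i01 : Integrable (fun a => l₀ + l₁ * a) μ := (integrable_const _).add (i1.const_mul _)
    rw [integral_add i01 (i2.const_mul _), integral_add (integrable_const _) (i1.const_mul _),
      integral_const_mul, integral_const_mul, hμ.mean, hμ.variance]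
    simp
  have ib : Integrable (fun a => C * |a| ^ 3 + C' * a ^ 6) μ :=
    (i3.const_mul _).add (hμ.integrable_pow_six.const_mul _)
  have hb : ∀ a, |h a - (l₀ + l₁ * a + l₂ * a ^ 2)| ≤ C * |a| ^ 3 + C' * a ^ 6 := fun a => by
    refine (ht a).trans (le_of_eq ?_)
    rw [← Even.pow_abs (show Even 6 by decide) a]
    ring
  have id : Integrable (fun a => h a - (l₀ + l₁ * a + l₂ * a ^ 2)) μ :=
    ib.mono' (by fun_prop) (Eventually.of_forall hb)
  have ih : Integrable h μ := (id.add ip).congr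
    (Eventually.of_forall fun a => by simp)
  rw [← ip', ← integral_sub ih ip]
  have hn : |∫ a, (h a - (l₀ + l₁ * a + l₂ * a ^ 2)) ∂μ| ≤ ∫ a, (C * |a| ^ 3 + C' * a ^ 6) ∂μ :=
    norm_integral_le_of_norm_le (f := fun a => h a - (l₀ + l₁ * a + l₂ * a ^ 2)) ib
      (Eventually.of_forall fun a => hb a)
  refine hn.trans ?_
  rw [integral_add (i3.const_mul _) (hμ.integrable_pow_six.const_mul _), integral_const_mul,
    integral_const_mul]
  have := hμ.integral_abs_pow_le (p := 3) (by norm_num)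
  have := hμ.integral_pow_six_le
  gcongr

end IsStandardLaw

theorem abs_sub_pow_three_le (x y : ℝ) : |x - y| ^ 3 ≤ 4 * |x| ^ 3 + 4 * |y| ^ 3 := by
  have h1 : |x - y| ≤ |x| + |y| := abs_sub x y
  have hx := abs_nonneg x
  have hy := abs_nonneg y
  calc |x - y| ^ 3 ≤ (|x| + |y|) ^ 3 := by gcongr
    _ ≤ 4 * |x| ^ 3 + 4 * |y| ^ 3 := by
      nlinarith [mul_nonneg (add_nonneg hx hy) (sq_nonneg (|x| - |y|))]

section OneEntry

variable {S : Type*} [Fintype S] [Nonempty S]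

/-- The mean of the cube of a residual under the Gibbs weights is at most its mean under the
weights from which the residual is removed. -/
theorem weightedMean_gibbs_cube_le (E R v : S → ℝ) {β V : ℝ} (hβ : 0 ≤ β)
    (hv : ∀ s, |v s| ≤ V) (t : ℝ) :
    weightedMean (fun s => Real.exp (E s - β / 2 * (R s - t * v s) ^ 2))
      (fun s => |R s - t * v s| ^ 3) ≤
    4 * weightedMean (fun s => Real.exp (E s)) (fun s => |R s| ^ 3) + 4 * V ^ 3 * |t| ^ 3 := by
  have hZ : 0 < ∑ s, Real.exp (E s) :=
    Finset.sum_pos (fun s _ => Real.exp_pos _) Finset.univ_nonempty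
  have h1 : (fun s => Real.exp (E s - β / 2 * (R s - t * v s) ^ 2)) =
      fun s => Real.exp (E s) * Real.exp (-(β / 2 * (R s - t * v s) ^ 2)) := by
    ext s
    rw [← Real.exp_add, sub_eq_add_neg]
  rw [h1]
  refine (weightedMean_mul_le_of_antivary (fun s => Real.exp_pos _) (fun s => Real.exp_pos _)
    fun s s' => ?_).trans ?_
  · rcases le_total |R s - t * v s| |R s' - t * v s'| with h | h
    · refine mul_nonpos_of_nonneg_of_nonpos (sub_nonneg.2 ?_) (sub_nonpos.2 (by gcongr))
      have := sq_le_sq.2 h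
      gcongr
    · refine mul_nonpos_of_nonpos_of_nonneg (sub_nonpos.2 ?_) (sub_nonneg.2 (by gcongr))
      have := sq_le_sq.2 h
      gcongr
  · rw [← weightedMean_const_mul, ← weightedMean_const hZ (4 * V ^ 3 * |t| ^ 3),
      ← weightedMean_add]
    refine weightedMean_mono (fun s => (Real.exp_pos _).le) fun s => ?_
    refine (abs_sub_pow_three_le _ _).trans ?_
    rw [abs_mul, mul_pow]
    have := pow_le_pow_left₀ (abs_nonneg _) (hv s) 3
    have h0 : 0 ≤ |t| ^ 3 := by positivity
    nlinarith [mul_le_mul_of_nonneg_left this h0]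

/-- Lindeberg replacement of a single entry. -/
theorem abs_integral_log_sum_exp_sub_le {K : ℝ} {μ ν : Measure ℝ} (hμ : IsStandardLaw K μ)
    (hν : IsStandardLaw K ν) (E R v : S → ℝ) {β V : ℝ} (hβ : 1 ≤ β) (hv : ∀ s, |v s| ≤ V) :
    |∫ a, Real.log (∑ s, Real.exp (E s - β / 2 * (R s - a * v s) ^ 2)) ∂μ
      - ∫ a, Real.log (∑ s, Real.exp (E s - β / 2 * (R s - a * v s) ^ 2)) ∂ν| ≤
    12 * β ^ 3 * V ^ 3 * ((1 + K) *
      (1 + 8 * weightedMean (fun s => Real.exp (E s)) (fun s => |R s| ^ 3)) + 8 * V ^ 3 * K) := by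
  have hV : 0 ≤ V := (abs_nonneg _).trans (hv (Classical.arbitrary S))
  have hβ0 : 0 < β := by linarith
  have hZ : ∀ q : S → ℝ, 0 < ∑ s, Real.exp (q s) := fun q =>
    Finset.sum_pos (fun s _ => Real.exp_pos _) Finset.univ_nonempty
  set D := weightedMean (fun s => Real.exp (E s)) (fun s => |R s| ^ 3) with hD
  have hD0 : 0 ≤ D := weightedMean_nonneg (fun s => (Real.exp_pos _).le) fun s => by positivity
  have hcont : Continuous fun a =>
      Real.log (∑ s, Real.exp (E s - β / 2 * (R s - a * v s) ^ 2)) :=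
    Continuous.log (by fun_prop) fun a => (hZ _).ne'
  have hd : ∀ s t, HasDerivAt (fun t => R s - t * v s) (- v s) t := fun s t => by
    simpa using ((hasDerivAt_id t).mul_const (v s)).const_sub (R s)
  obtain ⟨l₁, l₂, hl⟩ := abs_taylor_two_log_sum_exp_le
    (q := fun s t => E s - β / 2 * (R s - t * v s) ^ 2)
    (q' := fun s t => β * v s * (R s - t * v s)) (q'' := fun s => - (β * v s ^ 2))
    (c := β * V ^ 2)
    (fun s t => ((((hd s t).fun_pow 2).const_mul (β / 2)).const_sub (E s)).congr_deriv
      (by simp; ring))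
    (fun s t => ((hd s t).const_mul (β * v s)).congr_deriv (by ring))
    (fun s => by
      rw [abs_neg, abs_mul, abs_pow, abs_of_pos hβ0]
      have := hv s
      gcongr)
  have key : ∀ a, |Real.log (∑ s, Real.exp (E s - β / 2 * (R s - a * v s) ^ 2)) -
      (Real.log (∑ s, Real.exp (E s - β / 2 * (R s - 0 * v s) ^ 2)) + l₁ * a + l₂ * a ^ 2)| ≤
      (6 * β ^ 3 * V ^ 3 * (1 + 8 * D) + 6 * β ^ 3 * V ^ 3 * (8 * V ^ 3) * |a| ^ 3)
        * |a| ^ 3 := by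
    intro a
    refine hl a _ fun t ht => ?_
    have hw : ∀ s, 0 ≤ Real.exp (E s - β / 2 * (R s - t * v s) ^ 2) :=
      fun s => (Real.exp_pos _).le
    have h3 := weightedMean_gibbs_cube_le E R v hβ0.le hv t
    have h4 : |t| ^ 3 ≤ |a| ^ 3 := by gcongr
    rw [← hD] at h3
    rw [← weightedMean_const_mul, ← weightedMean_const_mul, ← weightedMean_add]
    calc _ ≤ weightedMean (fun s => Real.exp (E s - β / 2 * (R s - t * v s) ^ 2))
          (fun s => 6 * β ^ 3 * V ^ 3 * (1 + 2 * |R s - t * v s| ^ 3)) := by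
          refine weightedMean_mono hw fun s => ?_
          rw [abs_mul, abs_mul, abs_of_pos hβ0]
          have hs := hv s
          set r := |R s - t * v s|
          have hr : 0 ≤ r := abs_nonneg _
          have hr3 : r ≤ 1 + r ^ 3 := by
            rcases le_total r 1 with h | h
            · have : 0 ≤ r ^ 3 := by positivity
              linarith
            · have := le_self_pow₀ h (three_ne_zero)
              linarith
          have hβ23 : β ^ 2 ≤ β ^ 3 := pow_le_pow_right₀ hβ (by norm_num)
          calc 6 * (β * V ^ 2) * (β * |v s| * r) + 6 * (β * |v s| * r) ^ 3
              ≤ 6 * (β * V ^ 2) * (β * V * r) + 6 * (β * V * r) ^ 3 := by gcongr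
            _ = 6 * β ^ 2 * V ^ 3 * r + 6 * β ^ 3 * V ^ 3 * r ^ 3 := by ring
            _ ≤ 6 * β ^ 3 * V ^ 3 * (1 + r ^ 3) + 6 * β ^ 3 * V ^ 3 * r ^ 3 := by gcongr
            _ = _ := by ring
      _ ≤ 6 * β ^ 3 * V ^ 3 * (1 + 2 * (4 * D + 4 * V ^ 3 * |a| ^ 3)) := by
          rw [weightedMean_const_mul, weightedMean_add, weightedMean_const (hZ _),
            weightedMean_const_mul]
          have : 4 * V ^ 3 * |t| ^ 3 ≤ 4 * V ^ 3 * |a| ^ 3 := by gcongr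
          gcongr
          linarith
      _ = _ := by ring
  have m1 := hμ.abs_integral_sub_le_of_taylor hcont (by positivity) (by positivity) key
  have m2 := hν.abs_integral_sub_le_of_taylor hcont (by positivity) (by positivity) key
  rw [abs_le] at m1 m2 ⊢
  constructor <;> linarith

end OneEntry

section Pi

variable {ι : Type*} [Fintype ι] [DecidableEq ι]

/-- Resampling one coordinate of a product measure. -/
theorem map_update_prod_pi (ρ : ι → Measure ℝ) [∀ i, IsProbabilityMeasure (ρ i)] (p : ι)
    (μ : Measure ℝ) [IsProbabilityMeasure μ] :
    ((Measure.pi ρ).prod μ).map (fun x => Function.update x.1 p x.2) =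
      Measure.pi (Function.update ρ p μ) := by
  have : ∀ i, IsProbabilityMeasure (Function.update ρ p μ i) := by
    intro i
    rcases eq_or_ne i p with rfl | h
    · simpa
    · simpa [h] using inferInstanceAs (IsProbabilityMeasure (ρ i))
  have hm : Measurable fun x : (ι → ℝ) × ℝ => Function.update x.1 p x.2 := by
    refine measurable_pi_lambda _ fun i => ?_
    rcases eq_or_ne i p with rfl | h
    · simpa using measurable_snd
    · simp only [Function.update_of_ne h]
      fun_prop
  refine (Measure.pi_eq fun s hs => ?_).symm
  rw [Measure.map_apply hm (MeasurableSet.univ_pi hs)]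
  have hpre : (fun x : (ι → ℝ) × ℝ => Function.update x.1 p x.2) ⁻¹' Set.univ.pi s =
      (Set.univ.pi (Function.update s p Set.univ)) ×ˢ s p := by
    ext x
    simp only [Set.mem_preimage, Set.mem_pi, Set.mem_univ, true_imp_iff, Set.mem_prod]
    constructor
    · refine fun h => ⟨fun i => ?_, by simpa using h p⟩
      rcases eq_or_ne i p with rfl | hi
      · simp
      · simpa [hi] using h i
    · rintro ⟨h, hp⟩ i
      rcases eq_or_ne i p with rfl | hi
      · simpa
      · simpa [hi] using h i
  rw [hpre, Measure.prod_prod, Measure.pi_pi,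
    ← Finset.mul_prod_erase Finset.univ _ (Finset.mem_univ p),
    ← Finset.mul_prod_erase Finset.univ (fun i => (Function.update ρ p μ i) (s i))
      (Finset.mem_univ p)]
  simp only [Function.update_self, measure_univ, one_mul]
  rw [mul_comm]
  congr 1
  refine Finset.prod_congr rfl fun i hi => ?_
  rw [Function.update_of_ne (Finset.ne_of_mem_erase hi),
    Function.update_of_ne (Finset.ne_of_mem_erase hi)]

/-- The telescoping step of Lindeberg's method. -/
theorem abs_integral_pi_sub_le_sum {μ ν : Measure ℝ} (F : (ι → ℝ) → ℝ) (ε : ι → ℝ)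
    (h : ∀ ρ : ι → Measure ℝ, (∀ i, ρ i = μ ∨ ρ i = ν) → ∀ p,
      |∫ x, F x ∂Measure.pi (Function.update ρ p μ)
        - ∫ x, F x ∂Measure.pi (Function.update ρ p ν)| ≤ ε p) :
    |∫ x, F x ∂Measure.pi (fun _ : ι => μ) - ∫ x, F x ∂Measure.pi (fun _ : ι => ν)|
      ≤ ∑ p, ε p := by
  have key : ∀ T : Finset ι, |∫ x, F x ∂Measure.pi (fun _ : ι => μ)
      - ∫ x, F x ∂Measure.pi (fun i : ι => if i ∈ T then ν else μ)| ≤ ∑ p ∈ T, ε p := by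
    intro T
    induction T using Finset.induction_on with
    | empty => simp
    | insert p T hp ih =>
      set ρ : ι → Measure ℝ := fun i => if i ∈ T then ν else μ with hρ
      have h1 : Function.update ρ p μ = ρ := by
        rw [Function.update_eq_self_iff]
        simp [hρ, hp]
      have h2 : Function.update ρ p ν = fun i => if i ∈ insert p T then ν else μ := by
        ext1 i
        rcases eq_or_ne i p with rfl | hi <;> simp [*]
      have h3 := h ρ (fun i => by by_cases hi : i ∈ T <;> simp [hρ, hi]) p
      rw [h1, h2] at h3
      rw [Finset.sum_insert hp]
      rw [abs_le] at *
      constructor <;> linarith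
  simpa using key Finset.univ

/-- Functions of disjoint sets of coordinates are uncorrelated under a product measure. -/
theorem integral_pi_mul_of_dependsOn (ρ : ι → Measure ℝ) [∀ i, IsProbabilityMeasure (ρ i)]
    (T : Finset ι) {f g : (ι → ℝ) → ℝ} (hf : Measurable f) (hg : Measurable g)
    (hfT : DependsOn f (T : Set ι)) (hgT : DependsOn g (Tᶜ : Set ι)) :
    ∫ x, f x * g x ∂Measure.pi ρ = (∫ x, f x ∂Measure.pi ρ) * ∫ x, g x ∂Measure.pi ρ := by
  have hi : iIndepFun (fun i (x : ι → ℝ) => x i) (Measure.pi ρ) :=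
    iIndepFun_pi (X := fun _ a => a) (fun i => measurable_id.aemeasurable)
  let ext (U : Finset ι) (b : U → ℝ) (i : ι) : ℝ := if h : i ∈ U then b ⟨i, h⟩ else 0
  have hext : ∀ U, Measurable (ext U) := by
    refine fun U => measurable_pi_lambda _ fun i => ?_
    by_cases h : i ∈ U
    · simp only [ext, h, dif_pos]; fun_prop
    · simp only [ext, h, dif_neg, not_false_eq_true]; fun_prop
  have h := (hi.indepFun_finset T Tᶜ disjoint_compl_right (fun i => measurable_pi_apply i)).comp
    (hf.comp (hext T)) (hg.comp (hext Tᶜ))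
  have e1 : (f ∘ ext T) ∘ (fun (x : ι → ℝ) (i : T) => x i) = f := by
    ext x
    exact hfT fun i hi => by simp [ext, Finset.mem_coe.1 hi]
  have e2 : (g ∘ ext Tᶜ) ∘ (fun (x : ι → ℝ) (i : (Tᶜ : Finset ι)) => x i) = g := by
    ext x
    refine hgT fun i hi => ?_
    have : i ∉ T := by simpa using hi
    simp [ext, this]
  rw [e1, e2] at h
  exact h.integral_fun_mul_eq_mul_integral hf.aestronglyMeasurable hg.aestronglyMeasurable

end Pi

section FourthMoment

variable {Ω ι : Type*} [MeasurableSpace Ω] {P : Measure Ω} [IsProbabilityMeasure P]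

theorem MeasureTheory.MemLp.integrable_pow_of_le_four {X : Ω → ℝ} (hX : MemLp X 4 P) {p : ℕ}
    (hp : p ≤ 4) : Integrable (fun ω => X ω ^ p) P := by
  rcases Nat.eq_zero_or_pos p with rfl | h0
  · simp
  · have h := (hX.mono_exponent (p := (p : ENNReal)) (by exact_mod_cast hp)).integrable_norm_pow
      h0.ne'
    refine h.mono' (hX.1.pow p) (Eventually.of_forall fun ω => ?_)
    rw [norm_pow]

/-- Fourth moment of a sum of independent centered random variables. -/
theorem integral_sum_pow_four_le {X : ι → Ω → ℝ} (hX : iIndepFun X P)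
    (hm : ∀ i, Measurable (X i)) (hL : ∀ i, MemLp (X i) 4 P) (h1 : ∀ i, ∫ ω, X i ω ∂P = 0)
    {τ κ : ℝ} (h2 : ∀ i, ∫ ω, X i ω ^ 2 ∂P ≤ τ) (h4 : ∀ i, ∫ ω, X i ω ^ 4 ∂P ≤ κ) (N : ℕ)
    (J : Finset ι) (hJ : J.card ≤ N) :
    ∫ ω, (∑ i ∈ J, X i ω) ^ 4 ∂P ≤ J.card * (6 * N * τ ^ 2 + κ) := by
  classical
  suffices (∫ ω, (∑ i ∈ J, X i ω) ∂P = 0) ∧ (∫ ω, (∑ i ∈ J, X i ω) ^ 2 ∂P ≤ J.card * τ) ∧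
    ∫ ω, (∑ i ∈ J, X i ω) ^ 4 ∂P ≤ J.card * (6 * N * τ ^ 2 + κ) from this.2.2
  induction J using Finset.induction_on with
  | empty => simp
  | insert i J hi ih =>
    rw [Finset.card_insert_of_notMem hi] at hJ
    obtain ⟨ih1, ih2, ih4⟩ := ih (by omega)
    have hτ : 0 ≤ τ := (integral_nonneg fun ω => sq_nonneg _).trans (h2 i)
    have hind : IndepFun (fun ω => ∑ j ∈ J, X j ω) (X i) P := by
      have := hX.indepFun_finsetSum_of_notMem hm hi
      convert this using 1
      ext ω
      simp
    have hSL : MemLp (fun ω => ∑ j ∈ J, X j ω) 4 P := memLp_finsetSum _ fun j _ => hL j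
    have hSm : Measurable fun ω => ∑ j ∈ J, X j ω := Finset.measurable_fun_sum _ fun j _ => hm j
    set S := fun ω => ∑ j ∈ J, X j ω with hS
    have hpow : ∀ p q, p ≤ 4 → q ≤ 4 → Integrable (fun ω => S ω ^ p * X i ω ^ q) P ∧
        ∫ ω, S ω ^ p * X i ω ^ q ∂P = (∫ ω, S ω ^ p ∂P) * ∫ ω, X i ω ^ q ∂P := by
      intro p q hp hq
      have h := hind.comp (φ := fun x => x ^ p) (ψ := fun x => x ^ q) (by fun_prop) (by fun_prop)
      exact ⟨h.integrable_mul (hSL.integrable_pow_of_le_four hp)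
        ((hL i).integrable_pow_of_le_four hq),
        h.integral_fun_mul_eq_mul_integral (hSm.pow_const p).aestronglyMeasurable
          ((hm i).pow_const q).aestronglyMeasurable⟩
    have hsum : ∀ ω, ∑ j ∈ insert i J, X j ω = S ω + X i ω := fun ω => by
      rw [Finset.sum_insert hi, add_comm]
    have s1 := hSL.integrable_pow_of_le_four (p := 1) (by norm_num)
    have x1 := (hL i).integrable_pow_of_le_four (p := 1) (by norm_num)
    have s2 := hSL.integrable_pow_of_le_four (p := 2) (by norm_num)
    have x2 := (hL i).integrable_pow_of_le_four (p := 2) (by norm_num)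
    have s4 := hSL.integrable_pow_of_le_four (p := 4) (by norm_num)
    have x4 := (hL i).integrable_pow_of_le_four (p := 4) (by norm_num)
    obtain ⟨i11, e11⟩ := hpow 1 1 (by norm_num) (by norm_num)
    obtain ⟨i13, e13⟩ := hpow 1 3 (by norm_num) (by norm_num)
    obtain ⟨i22, e22⟩ := hpow 2 2 (by norm_num) (by norm_num)
    obtain ⟨i31, e31⟩ := hpow 3 1 (by norm_num) (by norm_num)
    have hS0 : ∫ ω, S ω ∂P = 0 := ih1
    simp only [pow_one, h1 i, hS0, zero_mul, mul_zero] at s1 x1 i11 e11 i13 e13 i31 e31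
    simp only [hsum]
    rw [Finset.card_insert_of_notMem hi]
    push_cast
    refine ⟨?_, ?_, ?_⟩
    · rw [integral_add s1 x1, hS0, h1 i, add_zero]
    · have : ∀ ω, (S ω + X i ω) ^ 2 = S ω ^ 2 + (2 * (S ω * X i ω) + X i ω ^ 2) :=
        fun ω => by ring
      simp only [this]
      rw [integral_add s2 ((i11.const_mul 2).fun_add x2), integral_add (i11.const_mul 2) x2,
        integral_const_mul, e11]
      linarith [h2 i]
    · have : ∀ ω, (S ω + X i ω) ^ 4 = S ω ^ 4 + (4 * (S ω ^ 3 * X i ω) +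
          (6 * (S ω ^ 2 * X i ω ^ 2) + (4 * (S ω * X i ω ^ 3) + X i ω ^ 4))) :=
        fun ω => by ring
      simp only [this]
      have j1 := (i13.const_mul 4).fun_add x4
      have j2 := (i22.const_mul 6).fun_add j1
      have j3 := (i31.const_mul 4).fun_add j2
      rw [integral_add s4 j3, integral_add (i31.const_mul 4) j2,
        integral_add (i22.const_mul 6) j1, integral_add (i13.const_mul 4) x4,
        integral_const_mul, integral_const_mul, integral_const_mul, e13, e22, e31]
      have hp : (∫ ω, S ω ^ 2 ∂P) * ∫ ω, X i ω ^ 2 ∂P ≤ N * τ ^ 2 := by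
        have hN : (J.card : ℝ) ≤ N := by exact_mod_cast (by omega : J.card ≤ N)
        have hX0 : 0 ≤ ∫ ω, X i ω ^ 2 ∂P := integral_nonneg fun ω => sq_nonneg _
        calc (∫ ω, S ω ^ 2 ∂P) * ∫ ω, X i ω ^ 2 ∂P ≤ (J.card * τ) * τ :=
              mul_le_mul ih2 (h2 i) hX0 (by positivity)
          _ ≤ (N * τ) * τ := by gcongr
          _ = N * τ ^ 2 := by ring
      linarith [h4 i]

end FourthMoment

/-- The log-partition function of the quadratic energies
`β / 2 * ∑ i, (z i - ∑ j, a (i, j) * v s j) ^ 2 - e s`. -/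
noncomputable def logPartition {S : Type*} [Fintype S] {m n : ℕ} (β : ℝ) (e : S → ℝ)
    (v : S → Fin n → ℝ) (z : Fin m → ℝ) (a : Fin m × Fin n → ℝ) : ℝ :=
  Real.log (∑ s, Real.exp (e s - β / 2 * ∑ i, (z i - ∑ j, a (i, j) * v s j) ^ 2))

section LogPartition

variable {S : Type*} [Fintype S] {m n : ℕ}

theorem abs_log_sum_exp_le [Nonempty S] (y : S → ℝ) :
    |Real.log (∑ s, Real.exp (y s))| ≤ Real.log (Fintype.card S) + ∑ s, |y s| := by
  have hc : (1 : ℝ) ≤ Fintype.card S := by exact_mod_cast Fintype.card_pos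
  have hpos : 0 < ∑ s, Real.exp (y s) :=
    Finset.sum_pos (fun s _ => Real.exp_pos _) Finset.univ_nonempty
  have hle : ∀ s, |y s| ≤ ∑ s, |y s| := fun s =>
    Finset.single_le_sum (f := fun s => |y s|) (fun s _ => abs_nonneg _) (Finset.mem_univ s)
  rw [abs_le]
  constructor
  · have s₀ := Classical.arbitrary S
    have h1 : y s₀ ≤ Real.log (∑ s, Real.exp (y s)) := by
      rw [Real.le_log_iff_exp_le hpos]
      exact Finset.single_le_sum (f := fun s => Real.exp (y s)) (fun s _ => (Real.exp_pos _).le)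
        (Finset.mem_univ s₀)
    have h2 := neg_abs_le (y s₀)
    have h3 := Real.log_nonneg hc
    linarith [hle s₀]
  · rw [Real.log_le_iff_le_exp hpos, Real.exp_add, Real.exp_log (by linarith)]
    calc ∑ s, Real.exp (y s) ≤ ∑ _s : S, Real.exp (∑ s, |y s|) :=
          Finset.sum_le_sum fun s _ => Real.exp_le_exp.2 ((le_abs_self _).trans (hle s))
      _ = _ := by simp

theorem continuous_logPartition [Nonempty S] (β : ℝ) (e : S → ℝ) (v : S → Fin n → ℝ)
    (z : Fin m → ℝ) : Continuous (logPartition β e v z) :=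
  Continuous.log (by fun_prop) fun _ =>
    (Finset.sum_pos (fun _ _ => Real.exp_pos _) Finset.univ_nonempty).ne'

theorem sum_update_mul_eq (a : Fin m × Fin n → ℝ) (i : Fin m) (j : Fin n) (t : ℝ)
    (v : Fin n → ℝ) : ∑ j', Function.update a (i, j) t (i, j') * v j' =
      ∑ j' ∈ Finset.univ.erase j, a (i, j') * v j' + t * v j := by
  rw [← Finset.add_sum_erase Finset.univ _ (Finset.mem_univ j), add_comm,
    Function.update_self]
  congr 1
  refine Finset.sum_congr rfl fun j' hj' => ?_
  rw [Function.update_of_ne]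
  simpa using Finset.ne_of_mem_erase hj'

theorem logPartition_update (β : ℝ) (e : S → ℝ) (v : S → Fin n → ℝ) (z : Fin m → ℝ)
    (a : Fin m × Fin n → ℝ) (i : Fin m) (j : Fin n) (t : ℝ) :
    logPartition β e v z (Function.update a (i, j) t) =
      Real.log (∑ s, Real.exp ((e s - β / 2 *
          ∑ i' ∈ Finset.univ.erase i, (z i' - ∑ j', a (i', j') * v s j') ^ 2) -
        β / 2 * ((z i - ∑ j' ∈ Finset.univ.erase j, a (i, j') * v s j') - t * v s j) ^ 2)) := by
  unfold logPartition
  congr 1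
  refine Finset.sum_congr rfl fun s _ => ?_
  congr 1
  rw [← Finset.add_sum_erase Finset.univ _ (Finset.mem_univ i), sum_update_mul_eq]
  have : ∑ i' ∈ Finset.univ.erase i,
      (z i' - ∑ j', Function.update a (i, j) t (i', j') * v s j') ^ 2 =
      ∑ i' ∈ Finset.univ.erase i, (z i' - ∑ j', a (i', j') * v s j') ^ 2 := by
    refine Finset.sum_congr rfl fun i' hi' => ?_
    congr 2
    refine Finset.sum_congr rfl fun j' _ => ?_
    rw [Function.update_of_ne]
    simp [Finset.ne_of_mem_erase hi']
  rw [this]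
  ring

end LogPartition

section ProductLaw

variable {ι : Type*} [Fintype ι] {K : ℝ} {ρ : ι → Measure ℝ}

theorem integral_pi_comp_eval [∀ i, IsProbabilityMeasure (ρ i)] (i : ι) {φ : ℝ → ℝ}
    (hφ : Measurable φ) : ∫ x, φ (x i) ∂Measure.pi ρ = ∫ a, φ a ∂ρ i := by
  have h := measurePreserving_eval ρ i
  rw [← h.map_eq, integral_map h.aemeasurable hφ.aestronglyMeasurable]

theorem memLp_eval_pi [∀ i, IsProbabilityMeasure (ρ i)] (hρ : ∀ i, IsStandardLaw K (ρ i))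
    (i : ι) : MemLp (fun x : ι → ℝ => x i) 4 (Measure.pi ρ) := by
  have h : MemLp (fun a : ℝ => a) 4 (ρ i) := by
    have h4 := (hρ i).integrable_abs_pow (p := 4) (by norm_num)
    rw [← integrable_norm_rpow_iff (by fun_prop) (by norm_num) (by norm_num)]
    refine h4.congr (Eventually.of_forall fun a => ?_)
    simp only [show (4 : ENNReal).toReal = ((4 : ℕ) : ℝ) by norm_num, Real.rpow_natCast,
      Real.norm_eq_abs]
  exact h.comp_measurePreserving (measurePreserving_eval ρ i)

/-- Fourth moment of a linear form in independent standard variables. -/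
theorem integral_linear_form_pow_four_le [∀ i, IsProbabilityMeasure (ρ i)]
    (hK : 0 ≤ K) (hρ : ∀ i, IsStandardLaw K (ρ i)) {κ : Type*} (q : κ → ι) (hq : Function.Injective q)
    {v : κ → ℝ} {V : ℝ} (hv : ∀ j, |v j| ≤ V) (J : Finset κ) {N : ℕ} (hJ : J.card ≤ N) :
    ∫ x, (∑ j ∈ J, x (q j) * v j) ^ 4 ∂Measure.pi ρ ≤ N * (6 * N + (1 + K)) * V ^ 4 := by
  have hi : iIndepFun (fun i (x : ι → ℝ) => x i) (Measure.pi ρ) :=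
    iIndepFun_pi (X := fun _ a => a) (fun i => measurable_id.aemeasurable)
  have hi' : iIndepFun (fun j (x : ι → ℝ) => x (q j) * v j) (Measure.pi ρ) :=
    (hi.precomp hq).comp (fun j a => a * v j) (fun j => by fun_prop)
  have hv2 : ∀ j, v j ^ 2 ≤ V ^ 2 := fun j => by
    rw [← sq_abs (v j)]; exact pow_le_pow_left₀ (abs_nonneg _) (hv j) 2
  have hv4 : ∀ j, v j ^ 4 ≤ V ^ 4 := fun j => by
    rw [← Even.pow_abs (show Even 4 by decide)]; exact pow_le_pow_left₀ (abs_nonneg _) (hv j) 4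
  have h := integral_sum_pow_four_le hi' (fun j => by fun_prop)
    (fun j => (memLp_eval_pi hρ (q j)).mul_const (v j))
    (fun j => by
      rw [integral_mul_const, integral_pi_comp_eval (q j) measurable_id', (hρ (q j)).mean,
        zero_mul])
    (τ := V ^ 2) (κ := (1 + K) * V ^ 4)
    (fun j => by
      simp only [mul_pow]
      rw [integral_mul_const, integral_pi_comp_eval (q j) (φ := fun a => a ^ 2) (by fun_prop),
        (hρ (q j)).variance, one_mul]
      exact hv2 j)
    (fun j => by
      simp only [mul_pow]
      rw [integral_mul_const, integral_pi_comp_eval (q j) (φ := fun a => a ^ 4) (by fun_prop)]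
      have := (hρ (q j)).integral_abs_pow_le (p := 4) (by norm_num)
      simp only [Even.pow_abs (show Even 4 by decide)] at this
      exact mul_le_mul this (hv4 j) (by positivity) (by linarith))
    N J hJ
  refine h.trans ?_
  have : (J.card : ℝ) ≤ N := by exact_mod_cast hJ
  calc (J.card : ℝ) * (6 * N * (V ^ 2) ^ 2 + (1 + K) * V ^ 4)
      ≤ N * (6 * N * (V ^ 2) ^ 2 + (1 + K) * V ^ 4) := by gcongr
    _ = _ := by ring

theorem abs_cube_le_one_add_pow_four (x : ℝ) : |x| ^ 3 ≤ 1 + x ^ 4 := by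
  have h4 : x ^ 4 = |x| ^ 4 := (Even.pow_abs (by decide) x).symm
  rcases le_total |x| 1 with h | h
  · have := pow_le_one₀ (n := 3) (abs_nonneg x) h
    have : 0 ≤ |x| ^ 4 := by positivity
    linarith
  · have := pow_le_pow_right₀ h (show 3 ≤ 4 by norm_num)
    linarith

theorem memLp_linear_form [∀ i, IsProbabilityMeasure (ρ i)] (hρ : ∀ i, IsStandardLaw K (ρ i))
    {κ : Type*} (q : κ → ι) (v : κ → ℝ) (J : Finset κ) (c : ℝ) :
    MemLp (fun x => c - ∑ j ∈ J, x (q j) * v j) 4 (Measure.pi ρ) :=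
  (memLp_const c).sub (memLp_finsetSum _ fun j _ => (memLp_eval_pi hρ (q j)).mul_const (v j))

theorem integrable_abs_cube_linear_form [∀ i, IsProbabilityMeasure (ρ i)]
    (hρ : ∀ i, IsStandardLaw K (ρ i)) {κ : Type*} (q : κ → ι) (v : κ → ℝ) (J : Finset κ) (c : ℝ) :
    Integrable (fun x => |c - ∑ j ∈ J, x (q j) * v j| ^ 3) (Measure.pi ρ) := by
  simpa using ((memLp_linear_form hρ q v J c).integrable_pow_of_le_four
    (p := 3) (by norm_num)).norm

theorem integral_abs_cube_linear_form_le [∀ i, IsProbabilityMeasure (ρ i)]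
    (hK : 0 ≤ K) (hρ : ∀ i, IsStandardLaw K (ρ i)) {κ : Type*} (q : κ → ι) (hq : Function.Injective q)
    {v : κ → ℝ} {V : ℝ} (hv : ∀ j, |v j| ≤ V) (J : Finset κ) {N : ℕ} (hJ : J.card ≤ N) (c : ℝ) :
    ∫ x, |c - ∑ j ∈ J, x (q j) * v j| ^ 3 ∂Measure.pi ρ ≤
      1 + 8 * c ^ 4 + 8 * (N * (6 * N + (1 + K)) * V ^ 4) := by
  have hS : Integrable (fun x => (∑ j ∈ J, x (q j) * v j) ^ 4) (Measure.pi ρ) :=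
    (memLp_finsetSum J fun j _ =>
      (memLp_eval_pi hρ (q j)).mul_const (v j)).integrable_pow_of_le_four le_rfl
  have hb : ∀ x : ι → ℝ, |c - ∑ j ∈ J, x (q j) * v j| ^ 3 ≤
      (1 + 8 * c ^ 4) + 8 * (∑ j ∈ J, x (q j) * v j) ^ 4 := fun x => by
    refine (abs_cube_le_one_add_pow_four _).trans ?_
    set y := ∑ j ∈ J, x (q j) * v j
    have h1 : (c - y) ^ 2 ≤ 2 * (c ^ 2 + y ^ 2) := by nlinarith [sq_nonneg (c + y)]
    nlinarith [sq_nonneg (c ^ 2 - y ^ 2), pow_le_pow_left₀ (sq_nonneg _) h1 2]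
  calc ∫ x, |c - ∑ j ∈ J, x (q j) * v j| ^ 3 ∂Measure.pi ρ
      ≤ ∫ x, ((1 + 8 * c ^ 4) + 8 * (∑ j ∈ J, x (q j) * v j) ^ 4) ∂Measure.pi ρ :=
        integral_mono (integrable_abs_cube_linear_form hρ q v J c)
          ((integrable_const _).add (hS.const_mul 8)) hb
    _ = 1 + 8 * c ^ 4 + 8 * ∫ x, (∑ j ∈ J, x (q j) * v j) ^ 4 ∂Measure.pi ρ := by
        rw [integral_add (integrable_const _) (hS.const_mul 8), integral_const_mul]
        simp
    _ ≤ _ := by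
        have := integral_linear_form_pow_four_le hK hρ q hq hv J hJ
        linarith

end ProductLaw

section Swap

variable {S : Type*} [Fintype S] [Nonempty S] {K : ℝ}

theorem integral_weightedMean_le_of_dependsOn {ι : Type*} [Fintype ι] [DecidableEq ι]
    (ρ : ι → Measure ℝ) [∀ i, IsProbabilityMeasure (ρ i)] (T : Finset ι)
    {w f : S → (ι → ℝ) → ℝ} (hw : ∀ s, Measurable (w s)) (hw0 : ∀ s x, 0 < w s x)
    (hf : ∀ s, Measurable (f s)) (hwT : ∀ s, DependsOn (w s) (T : Set ι))
    (hfT : ∀ s, DependsOn (f s) (Tᶜ : Set ι)) (hfi : ∀ s, Integrable (f s) (Measure.pi ρ)) {M : ℝ}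
    (hM : ∀ s, ∫ x, f s x ∂Measure.pi ρ ≤ M) :
    Integrable (fun x => weightedMean (fun s => w s x) (fun s => f s x)) (Measure.pi ρ) ∧
      ∫ x, weightedMean (fun s => w s x) (fun s => f s x) ∂Measure.pi ρ ≤ M := by
  have hZ : ∀ x, 0 < ∑ s, w s x := fun x =>
    Finset.sum_pos (fun s _ => hw0 s x) Finset.univ_nonempty
  set u : S → (ι → ℝ) → ℝ := fun s x => w s x / ∑ s, w s x with hu
  have hum : ∀ s, Measurable (u s) := fun s =>
    (hw s).div (Finset.measurable_fun_sum _ fun s _ => hw s)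
  have hu0 : ∀ s x, 0 ≤ u s x := fun s x => div_nonneg (hw0 s x).le (hZ x).le
  have hu1 : ∀ x, ∑ s, u s x = 1 := fun x => by
    simp only [hu]
    rw [← Finset.sum_div, div_self (hZ x).ne']
  have hule : ∀ s x, u s x ≤ 1 := fun s x =>
    (Finset.single_le_sum (f := fun s => u s x) (fun s _ => hu0 s x) (Finset.mem_univ s)).trans
      (hu1 x).le
  have huT : ∀ s, DependsOn (u s) (T : Set ι) := fun s x y hxy => by
    simp only [hu]
    rw [hwT s hxy, Finset.sum_congr rfl fun s _ => hwT s hxy]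
  have hi : ∀ s, Integrable (fun x => u s x * f s x) (Measure.pi ρ) := fun s =>
    (hfi s).bdd_mul (c := 1) (hum s).aestronglyMeasurable (Eventually.of_forall fun x => by
      rw [Real.norm_eq_abs, abs_of_nonneg (hu0 s x)]; exact hule s x)
  have hui : ∀ s, Integrable (u s) (Measure.pi ρ) := fun s =>
    (integrable_const (1 : ℝ)).mono' (hum s).aestronglyMeasurable (Eventually.of_forall fun x => by
      rw [Real.norm_eq_abs, abs_of_nonneg (hu0 s x)]; exact hule s x)
  have heq : (fun x => weightedMean (fun s => w s x) (fun s => f s x)) =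
      fun x => ∑ s, u s x * f s x := by
    ext x
    simp only [weightedMean, hu, Finset.sum_div]
    exact Finset.sum_congr rfl fun s _ => by ring
  rw [heq]
  refine ⟨integrable_finsetSum _ fun s _ => hi s, ?_⟩
  rw [integral_finsetSum _ fun s _ => hi s]
  calc ∑ s, ∫ x, u s x * f s x ∂Measure.pi ρ
      = ∑ s, (∫ x, u s x ∂Measure.pi ρ) * ∫ x, f s x ∂Measure.pi ρ :=
        Finset.sum_congr rfl fun s _ =>
          integral_pi_mul_of_dependsOn ρ T (hum s) (hf s) (huT s) (hfT s)
    _ ≤ ∑ s, (∫ x, u s x ∂Measure.pi ρ) * M := by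
        gcongr with s
        · exact integral_nonneg (hu0 s)
        · exact hM s
    _ = (∫ x, ∑ s, u s x ∂Measure.pi ρ) * M := by
        rw [integral_finsetSum _ fun s _ => hui s, Finset.sum_mul]
    _ = M := by simp [hu1]

variable {m n : ℕ}

theorem integrable_logPartition {ρ : Fin m × Fin n → Measure ℝ}
    [∀ p, IsProbabilityMeasure (ρ p)] (hρ : ∀ p, IsStandardLaw K (ρ p)) (β : ℝ) (e : S → ℝ)
    (v : S → Fin n → ℝ) (z : Fin m → ℝ) :
    Integrable (logPartition β e v z) (Measure.pi ρ) := by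
  have hq : ∀ s i, Integrable (fun a : Fin m × Fin n → ℝ =>
      (z i - ∑ j, a (i, j) * v s j) ^ 2) (Measure.pi ρ) := fun s i =>
    (memLp_linear_form hρ (fun j => (i, j)) (v s) Finset.univ (z i)).integrable_pow_of_le_four
      (by norm_num)
  have hb : Integrable (fun a : Fin m × Fin n → ℝ => Real.log (Fintype.card S) +
      ∑ s, |e s - β / 2 * ∑ i, (z i - ∑ j, a (i, j) * v s j) ^ 2|) (Measure.pi ρ) :=
    (integrable_const _).add (integrable_finsetSum _ fun s _ =>
      ((integrable_const _).sub ((integrable_finsetSum _ fun i _ => hq s i).const_mul _)).abs)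
  exact hb.mono' (continuous_logPartition β e v z).aestronglyMeasurable
    (Eventually.of_forall fun a => abs_log_sum_exp_le _)

/-- The effect on the mean log-partition function of replacing the law of one matrix entry. -/
theorem abs_integral_logPartition_update_sub_le {μ ν : Measure ℝ} (hμ : IsStandardLaw K μ)
    (hν : IsStandardLaw K ν) {ρ : Fin m × Fin n → Measure ℝ}
    (hρ : ∀ p, IsStandardLaw K (ρ p)) (e : S → ℝ)
    {v : S → Fin n → ℝ} (z : Fin m → ℝ) {β V : ℝ} (hβ : 1 ≤ β) (hv : ∀ s j, |v s j| ≤ V)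
    (i : Fin m) (j : Fin n) :
    |∫ a, logPartition β e v z a ∂Measure.pi (Function.update ρ (i, j) μ)
      - ∫ a, logPartition β e v z a ∂Measure.pi (Function.update ρ (i, j) ν)| ≤
    12 * β ^ 3 * V ^ 3 * ((1 + K) *
      (1 + 8 * (1 + 8 * z i ^ 4 + 8 * (n * (6 * n + (1 + K)) * V ^ 4))) + 8 * V ^ 3 * K) := by
  have hK := hμ.nonneg
  have hV : 0 ≤ V := (abs_nonneg _).trans (hv (Classical.arbitrary S) j)
  have : ∀ p, IsProbabilityMeasure (ρ p) := fun p => (hρ p).isProbabilityMeasure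
  set E : S → (Fin m × Fin n → ℝ) → ℝ := fun s a => e s - β / 2 *
    ∑ i' ∈ Finset.univ.erase i, (z i' - ∑ j', a (i', j') * v s j') ^ 2 with hE
  set R : S → (Fin m × Fin n → ℝ) → ℝ := fun s a =>
    z i - ∑ j' ∈ Finset.univ.erase j, a (i, j') * v s j' with hR
  have hER : ∀ a t, logPartition β e v z (Function.update a (i, j) t) =
      Real.log (∑ s, Real.exp (E s a - β / 2 * (R s a - t * v s j) ^ 2)) :=
    fun a t => logPartition_update β e v z a i j t
  obtain ⟨hDi, hD⟩ := integral_weightedMean_le_of_dependsOn ρ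
    (Finset.univ.filter fun p : Fin m × Fin n => p.1 ≠ i)
    (w := fun s a => Real.exp (E s a)) (f := fun s a => |R s a| ^ 3)
    (M := 1 + 8 * z i ^ 4 + 8 * (n * (6 * n + (1 + K)) * V ^ 4))
    (fun s => by fun_prop) (fun s a => Real.exp_pos _) (fun s => by fun_prop)
    (fun s a b hab => by
      simp only [hE]
      congr 3
      refine Finset.sum_congr rfl fun i' hi' => ?_
      congr 2
      refine Finset.sum_congr rfl fun j' _ => ?_
      rw [hab (i', j') (by simpa using hi')])
    (fun s a b hab => by
      simp only [hR]
      congr 3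
      refine Finset.sum_congr rfl fun j' _ => ?_
      rw [hab (i, j') (by simp)])
    (fun s => integrable_abs_cube_linear_form hρ (fun j => (i, j)) (v s) _ (z i))
    (fun s => integral_abs_cube_linear_form_le hK hρ (fun j => (i, j))
      (fun _ _ h => (Prod.ext_iff.1 h).2) (hv s) _
      ((Finset.card_le_univ _).trans (Fintype.card_fin n).le) (z i))
  set D : (Fin m × Fin n → ℝ) → ℝ := fun a =>
    weightedMean (fun s => Real.exp (E s a)) (fun s => |R s a| ^ 3) with hDdef
  have fubini : ∀ μ : Measure ℝ, IsStandardLaw K μ →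
      Integrable (fun a => ∫ t, Real.log
        (∑ s, Real.exp (E s a - β / 2 * (R s a - t * v s j) ^ 2)) ∂μ) (Measure.pi ρ) ∧
      ∫ a, logPartition β e v z a ∂Measure.pi (Function.update ρ (i, j) μ) =
        ∫ a, ∫ t, Real.log (∑ s, Real.exp (E s a - β / 2 * (R s a - t * v s j) ^ 2)) ∂μ
          ∂Measure.pi ρ := by
    intro μ hμ
    have := hμ.isProbabilityMeasure
    have hmap := map_update_prod_pi ρ (i, j) μ
    have hρ' : ∀ p, IsStandardLaw K (Function.update ρ (i, j) μ p) := fun p => by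
      rcases eq_or_ne p (i, j) with rfl | hp
      · simpa
      · simpa [hp] using hρ p
    have : ∀ p, IsProbabilityMeasure (Function.update ρ (i, j) μ p) :=
      fun p => (hρ' p).isProbabilityMeasure
    have hint := integrable_logPartition hρ' β e v z
    have hm : Measurable fun x : (Fin m × Fin n → ℝ) × ℝ => Function.update x.1 (i, j) x.2 := by
      refine measurable_pi_lambda _ fun p => ?_
      rcases eq_or_ne p (i, j) with rfl | h
      · simpa using measurable_snd
      · simp only [Function.update_of_ne h]
        fun_prop
    rw [← hmap] at hint ⊢
    have hint' := (integrable_map_measure hint.1 hm.aemeasurable).1 hint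
    rw [integral_map hm.aemeasurable hint.1]
    simp only [Function.comp_def, hER] at hint' ⊢
    exact ⟨hint'.integral_prod_left, integral_prod _ hint'⟩
  rw [(fubini μ hμ).2, (fubini ν hν).2, ← integral_sub (fubini μ hμ).1 (fubini ν hν).1]
  have hbi : Integrable (fun a => 12 * β ^ 3 * V ^ 3 * ((1 + K) * (1 + 8 * D a) + 8 * V ^ 3 * K))
      (Measure.pi ρ) := by
    have h8 : Integrable (fun a => 1 + 8 * D a) (Measure.pi ρ) :=
      (integrable_const _).add (hDi.const_mul 8)
    exact ((h8.const_mul _).add (integrable_const _)).const_mul _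
  rw [← Real.norm_eq_abs]
  refine (norm_integral_le_of_norm_le hbi (Eventually.of_forall fun a => ?_)).trans ?_
  · exact abs_integral_log_sum_exp_sub_le hμ hν (fun s => E s a) (fun s => R s a)
      (fun s => v s j) hβ fun s => hv s j
  have h8 : Integrable (fun a => 1 + 8 * D a) (Measure.pi ρ) :=
    (integrable_const _).add (hDi.const_mul 8)
  rw [integral_const_mul, integral_add (h8.const_mul _) (integrable_const _), integral_const_mul,
    integral_add (integrable_const _) (hDi.const_mul 8), integral_const_mul]
  simp only [integral_const, probReal_univ, smul_eq_mul, one_mul]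
  have : 0 ≤ β := by linarith
  gcongr

/-- Universality of the mean log-partition function at fixed noise. -/
theorem abs_integral_logPartition_sub_le {μ ν : Measure ℝ} (hμ : IsStandardLaw K μ)
    (hν : IsStandardLaw K ν) (e : S → ℝ) {v : S → Fin n → ℝ} (z : Fin m → ℝ) {β V : ℝ}
    (hβ : 1 ≤ β) (hv : ∀ s j, |v s j| ≤ V) :
    |∫ a, logPartition β e v z a ∂Measure.pi (fun _ => μ)
      - ∫ a, logPartition β e v z a ∂Measure.pi (fun _ => ν)| ≤
    ∑ p : Fin m × Fin n, 12 * β ^ 3 * V ^ 3 * ((1 + K) *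
      (1 + 8 * (1 + 8 * z p.1 ^ 4 + 8 * (n * (6 * n + (1 + K)) * V ^ 4))) + 8 * V ^ 3 * K) :=
  abs_integral_pi_sub_le_sum _ _ fun ρ hρ p => abs_integral_logPartition_update_sub_le hμ hν
    (fun q => by rcases hρ q with h | h <;> rw [h] <;> assumption) e z hβ hv p.1 p.2

end Swap

theorem lassoObjective_mulVec_add {m n : ℕ} (lam : ℝ) (A : Matrix (Fin m) (Fin n) ℝ)
    (x₀ : Fin n → ℝ) (z : Fin m → ℝ) (x : Fin n → ℝ) :
    lassoObjective lam A (A *ᵥ x₀ + z) x =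
      1 / 2 * ∑ i, (z i - ∑ j, A i j * (x j - x₀ j)) ^ 2 + lam * ∑ j, |x j| := by
  unfold lassoObjective
  congr 2
  refine Finset.sum_congr rfl fun i _ => ?_
  congr 1
  simp only [Pi.add_apply, Matrix.mulVec, dotProduct, mul_sub, Finset.sum_sub_distrib]
  ring

section Deterministic

variable {m n : ℕ} {xmax : ℝ}

theorem abs_residual_le {x x₀ : Fin n → ℝ} (hx : ∀ j, |x j| ≤ xmax) (hx₀ : ∀ j, |x₀ j| ≤ xmax)
    (b : Fin n → ℝ) (c : ℝ) :
    |c - ∑ j, b j * (x j - x₀ j)| ≤ |c| + 2 * xmax * ∑ j, |b j| := by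
  refine (abs_sub _ _).trans ?_
  gcongr
  refine (Finset.abs_sum_le_sum_abs _ _).trans ?_
  rw [Finset.mul_sum]
  refine Finset.sum_le_sum fun j _ => ?_
  rw [abs_mul, mul_comm]
  have := (abs_sub (x j) (x₀ j)).trans (add_le_add (hx j) (hx₀ j))
  gcongr
  linarith

theorem sum_abs_sq_le (b : Fin n → ℝ) : (∑ j, |b j|) ^ 2 ≤ n * ∑ j, b j ^ 2 := by
  have := sq_sum_le_card_mul_sum_sq (s := Finset.univ) (f := fun j => |b j|)
  simpa using this

theorem mem_lassoBox_iff {x : Fin n → ℝ} : x ∈ lassoBox n xmax ↔ ∀ j, |x j| ≤ xmax := by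
  simp only [lassoBox, Set.mem_Icc, abs_le]
  rfl

/-- The LASSO objective is Lipschitz on the box in the supremum norm. -/
theorem abs_lassoObjective_sub_le {x x' x₀ : Fin n → ℝ} (hx : ∀ j, |x j| ≤ xmax)
    (hx' : ∀ j, |x' j| ≤ xmax) (hx₀ : ∀ j, |x₀ j| ≤ xmax) {δ : ℝ} (hδ : 0 ≤ δ)
    (hxx' : ∀ j, |x j - x' j| ≤ δ) (hxmax : 0 ≤ xmax) (lam : ℝ) (A : Matrix (Fin m) (Fin n) ℝ)
    (z : Fin m → ℝ) :
    |lassoObjective lam A (A *ᵥ x₀ + z) x - lassoObjective lam A (A *ᵥ x₀ + z) x'| ≤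
      δ * (|lam| * n + (∑ i, z i ^ 2 + (1 + 2 * xmax) * (n * ∑ i, ∑ j, A i j ^ 2))) := by
  rw [lassoObjective_mulVec_add, lassoObjective_mulVec_add]
  have h1 : |lam * (∑ j, |x j|) - lam * (∑ j, |x' j|)| ≤ δ * (|lam| * n) := by
    rw [← mul_sub, abs_mul, ← Finset.sum_sub_distrib]
    have : |∑ j, (|x j| - |x' j|)| ≤ n * δ := by
      refine (Finset.abs_sum_le_sum_abs _ _).trans ?_
      refine (Finset.sum_le_sum fun j _ => (abs_abs_sub_abs_le _ _).trans (hxx' j)).trans ?_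
      simp
    calc |lam| * |∑ j, (|x j| - |x' j|)| ≤ |lam| * (n * δ) := by gcongr
      _ = _ := by ring
  have h2 : |1 / 2 * ∑ i, (z i - ∑ j, A i j * (x j - x₀ j)) ^ 2 -
      1 / 2 * ∑ i, (z i - ∑ j, A i j * (x' j - x₀ j)) ^ 2| ≤
      δ * (∑ i, z i ^ 2 + (1 + 2 * xmax) * (n * ∑ i, ∑ j, A i j ^ 2)) := by
    rw [← mul_sub, ← Finset.sum_sub_distrib, Finset.mul_sum]
    refine (Finset.abs_sum_le_sum_abs _ _).trans ?_
    rw [Finset.mul_sum, Finset.mul_sum, ← Finset.sum_add_distrib, Finset.mul_sum]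
    refine Finset.sum_le_sum fun i _ => ?_
    have r1 := abs_residual_le hx hx₀ (A i) (z i)
    have r2 := abs_residual_le hx' hx₀ (A i) (z i)
    have hs := sum_abs_sq_le (A i)
    set p := ∑ j, |A i j|
    have hp : 0 ≤ p := Finset.sum_nonneg fun j _ => abs_nonneg _
    set r := z i - ∑ j, A i j * (x j - x₀ j) with hr
    set r' := z i - ∑ j, A i j * (x' j - x₀ j) with hr'
    have hd : |r - r'| ≤ δ * p := by
      have : r - r' = - ∑ j, A i j * (x j - x' j) := by
        rw [hr, hr', sub_sub_sub_cancel_left, ← Finset.sum_sub_distrib, ← Finset.sum_neg_distrib]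
        exact Finset.sum_congr rfl fun j _ => by ring
      rw [this, abs_neg, Finset.mul_sum]
      refine (Finset.abs_sum_le_sum_abs _ _).trans (Finset.sum_le_sum fun j _ => ?_)
      rw [abs_mul, mul_comm]
      exact mul_le_mul_of_nonneg_right (hxx' j) (abs_nonneg _)
    have hsum : |r + r'| ≤ 2 * (|z i| + 2 * xmax * p) := (abs_add_le _ _).trans (by linarith)
    have hz : |z i| * p ≤ z i ^ 2 + p ^ 2 := by
      nlinarith [sq_nonneg (|z i| - p), sq_abs (z i), sq_nonneg (|z i|), sq_nonneg p]
    calc |1 / 2 * (r ^ 2 - r' ^ 2)| = 1 / 2 * (|r - r'| * |r + r'|) := by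
          rw [← abs_mul, abs_mul (1 / 2), abs_of_pos (by norm_num : (0 : ℝ) < 1 / 2)]
          ring_nf
      _ ≤ 1 / 2 * (δ * p * (2 * (|z i| + 2 * xmax * p))) := by gcongr
      _ = δ * (|z i| * p + 2 * xmax * p ^ 2) := by ring
      _ ≤ δ * (z i ^ 2 + p ^ 2 + 2 * xmax * p ^ 2) := by gcongr
      _ = δ * (z i ^ 2 + (1 + 2 * xmax) * p ^ 2) := by ring
      _ ≤ δ * (z i ^ 2 + (1 + 2 * xmax) * (n * ∑ j, A i j ^ 2)) := by gcongr
  calc _ = |(1 / 2 * ∑ i, (z i - ∑ j, A i j * (x j - x₀ j)) ^ 2 -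
      1 / 2 * ∑ i, (z i - ∑ j, A i j * (x' j - x₀ j)) ^ 2) +
        (lam * (∑ j, |x j|) - lam * (∑ j, |x' j|))| := by congr 1; ring
    _ ≤ _ := by
      refine (abs_add_le _ _).trans ?_
      linarith

theorem abs_lassoObjective_le {x x₀ : Fin n → ℝ} (hx : ∀ j, |x j| ≤ xmax)
    (hx₀ : ∀ j, |x₀ j| ≤ xmax) (lam : ℝ) (A : Matrix (Fin m) (Fin n) ℝ)
    (z : Fin m → ℝ) :
    |lassoObjective lam A (A *ᵥ x₀ + z) x| ≤
      |lam| * (n * xmax) + (∑ i, z i ^ 2 + 4 * xmax ^ 2 * (n * ∑ i, ∑ j, A i j ^ 2)) := by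
  rw [lassoObjective_mulVec_add]
  have h1 : |lam * (∑ j, |x j|)| ≤ |lam| * (n * xmax) := by
    rw [abs_mul, abs_of_nonneg (Finset.sum_nonneg fun j _ => abs_nonneg (x j))]
    have : ∑ j, |x j| ≤ n * xmax := (Finset.sum_le_sum fun j _ => hx j).trans (by simp)
    gcongr
  have h2 : |1 / 2 * ∑ i, (z i - ∑ j, A i j * (x j - x₀ j)) ^ 2| ≤
      ∑ i, z i ^ 2 + 4 * xmax ^ 2 * (n * ∑ i, ∑ j, A i j ^ 2) := by
    rw [abs_of_nonneg (by positivity), Finset.mul_sum, Finset.mul_sum, Finset.mul_sum,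
      ← Finset.sum_add_distrib]
    refine Finset.sum_le_sum fun i _ => ?_
    have r1 := abs_residual_le hx hx₀ (A i) (z i)
    have hs := sum_abs_sq_le (A i)
    set p := ∑ j, |A i j|
    have hp : 0 ≤ p := Finset.sum_nonneg fun j _ => abs_nonneg _
    calc 1 / 2 * (z i - ∑ j, A i j * (x j - x₀ j)) ^ 2
        ≤ 1 / 2 * (|z i| + 2 * xmax * p) ^ 2 := by
          rw [← sq_abs (z i - _)]
          gcongr
      _ ≤ z i ^ 2 + 4 * xmax ^ 2 * p ^ 2 := by
          nlinarith [sq_nonneg (|z i| - 2 * xmax * p), sq_abs (z i)]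
      _ ≤ z i ^ 2 + 4 * xmax ^ 2 * (n * ∑ j, A i j ^ 2) := by gcongr
  refine (abs_add_le _ _).trans ?_
  linarith

theorem exists_mem_lassoBox_lassoMin_eq (hxmax : 0 ≤ xmax) (lam : ℝ)
    (A : Matrix (Fin m) (Fin n) ℝ) (y : Fin m → ℝ) :
    ∃ x, (∀ j, |x j| ≤ xmax) ∧ lassoObjective lam A y x = lassoMin xmax lam A y := by
  obtain ⟨x, hx, h⟩ := (lassoMin_isLeast hxmax lam A y).1
  exact ⟨x, mem_lassoBox_iff.1 hx, h⟩

theorem lassoMin_le (hxmax : 0 ≤ xmax) (lam : ℝ) (A : Matrix (Fin m) (Fin n) ℝ) (y : Fin m → ℝ)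
    {x : Fin n → ℝ} (hx : ∀ j, |x j| ≤ xmax) :
    lassoMin xmax lam A y ≤ lassoObjective lam A y x :=
  (lassoMin_isLeast hxmax lam A y).2 ⟨x, mem_lassoBox_iff.2 hx, rfl⟩

/-- A point of the grid with `N + 1` equally spaced values per coordinate in `[-xmax, xmax]`. -/
noncomputable def gridPoint (xmax : ℝ) {N : ℕ} (s : Fin n → Fin (N + 1)) (j : Fin n) : ℝ :=
  -xmax + 2 * xmax / N * (s j : ℕ)

theorem abs_gridPoint_le (hxmax : 0 ≤ xmax) {N : ℕ} (hN : 0 < N) (s : Fin n → Fin (N + 1))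
    (j : Fin n) : |gridPoint xmax s j| ≤ xmax := by
  have hN' : (0 : ℝ) < N := by exact_mod_cast hN
  have h1 : ((s j : ℕ) : ℝ) ≤ N := by exact_mod_cast Nat.lt_succ_iff.1 (s j).2
  have h2 : 2 * xmax / N * (s j : ℕ) ≤ 2 * xmax := by
    calc 2 * xmax / N * (s j : ℕ) ≤ 2 * xmax / N * N := by gcongr
      _ = 2 * xmax := by field_simp
  have h3 : 0 ≤ 2 * xmax / N * (s j : ℕ) := by positivity
  unfold gridPoint
  rw [abs_le]
  constructor <;> linarith

theorem exists_gridPoint_near (hxmax : 0 < xmax) {N : ℕ} (hN : 0 < N) {x : Fin n → ℝ}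
    (hx : ∀ j, |x j| ≤ xmax) :
    ∃ s : Fin n → Fin (N + 1), ∀ j, |gridPoint xmax s j - x j| ≤ 2 * xmax / N := by
  have hN' : (0 : ℝ) < N := by exact_mod_cast hN
  have key : ∀ j, ∃ k : Fin (N + 1), |-xmax + 2 * xmax / N * (k : ℕ) - x j| ≤ 2 * xmax / N := by
    intro j
    have hj := abs_le.1 (hx j)
    set y := (x j + xmax) * N / (2 * xmax) with hy
    have hy0 : 0 ≤ y := div_nonneg (mul_nonneg (by linarith) hN'.le) (by linarith)
    have hyN : y ≤ N := by
      rw [hy, div_le_iff₀ (by linarith)]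
      nlinarith
    have hxy : x j = -xmax + 2 * xmax / N * y := by
      rw [hy]
      field_simp
      ring
    have h1 := Nat.floor_le hy0
    have h2 := Nat.lt_floor_add_one y
    refine ⟨⟨⌊y⌋₊, Nat.lt_succ_iff.2 (Nat.floor_le_of_le hyN)⟩, ?_⟩
    rw [hxy, add_sub_add_left_eq_sub, ← mul_sub, abs_mul, abs_of_pos (by positivity)]
    refine mul_le_of_le_one_right (by positivity) ?_
    rw [abs_le]
    constructor <;> simp only <;> linarith
  choose k hk using key
  exact ⟨k, hk⟩

/-- The soft minimum of the LASSO objective over the grid, at inverse temperature `β`. -/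
noncomputable def softLassoCost (xmax lam β : ℝ) (N : ℕ) (x₀ : Fin n → ℝ) (z : Fin m → ℝ)
    (A : Matrix (Fin m) (Fin n) ℝ) : ℝ :=
  -(1 / (n * β)) * Real.log (∑ s : Fin n → Fin (N + 1),
    Real.exp (-β * lassoObjective lam A (A *ᵥ x₀ + z) (gridPoint xmax s)))

theorem softLassoCost_smul (lam : ℝ) {β : ℝ} (N : ℕ) (x₀ : Fin n → ℝ) (z : Fin m → ℝ)
    (c : ℝ) (a : Fin m × Fin n → ℝ) :
    softLassoCost xmax lam β N x₀ z (c • Matrix.of fun i j => a (i, j)) =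
      -(1 / (n * β)) * logPartition β
        (fun s : Fin n → Fin (N + 1) => -β * (lam * ∑ j, |gridPoint xmax s j|))
        (fun s j => c * (gridPoint xmax s j - x₀ j)) z a := by
  unfold softLassoCost logPartition
  congr 2
  refine Finset.sum_congr rfl fun s _ => ?_
  congr 1
  rw [lassoObjective_mulVec_add]
  have : ∀ i, ∑ j, (c • Matrix.of fun i j => a (i, j)) i j * (gridPoint xmax s j - x₀ j) =
      ∑ j, a (i, j) * (c * (gridPoint xmax s j - x₀ j)) := fun i =>
    Finset.sum_congr rfl fun j _ => by
      simp only [Matrix.smul_apply, Matrix.of_apply, smul_eq_mul]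
      ring
  simp only [this]
  ring

theorem abs_lassoCost_sub_softLassoCost_le (hxmax : 0 < xmax) (lam : ℝ) {β : ℝ} (hβ : 0 < β)
    {N : ℕ} (hN : 0 < N) (hn : 0 < n) {x₀ : Fin n → ℝ} (hx₀ : ∀ j, |x₀ j| ≤ xmax)
    (z : Fin m → ℝ) (A : Matrix (Fin m) (Fin n) ℝ) :
    |lassoCost xmax lam x₀ z A - softLassoCost xmax lam β N x₀ z A| ≤
      Real.log (N + 1) / β + 2 * xmax / N *
        (|lam| + (1 / n * ∑ i, z i ^ 2 + (1 + 2 * xmax) * ∑ i, ∑ j, A i j ^ 2)) := by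
  have hn' : (0 : ℝ) < n := by exact_mod_cast hn
  set H : (Fin n → ℝ) → ℝ := lassoObjective lam A (A *ᵥ x₀ + z) with hH
  set l := lassoMin xmax lam A (A *ᵥ x₀ + z) with hl
  set Λ := Real.log (∑ s : Fin n → Fin (N + 1), Real.exp (-β * H (gridPoint xmax s))) with hΛ
  have hpos : 0 < ∑ s : Fin n → Fin (N + 1), Real.exp (-β * H (gridPoint xmax s)) :=
    Finset.sum_pos (fun s _ => Real.exp_pos _) Finset.univ_nonempty
  have hup : Λ ≤ n * Real.log (N + 1) - β * l := by
    rw [hΛ, Real.log_le_iff_le_exp hpos]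
    calc ∑ s : Fin n → Fin (N + 1), Real.exp (-β * H (gridPoint xmax s))
        ≤ ∑ _s : Fin n → Fin (N + 1), Real.exp (-β * l) := by
          refine Finset.sum_le_sum fun s _ => Real.exp_le_exp.2 ?_
          have := lassoMin_le hxmax.le lam A (A *ᵥ x₀ + z) (abs_gridPoint_le hxmax.le hN s)
          nlinarith
      _ = Real.exp (n * Real.log (N + 1) - β * l) := by
          rw [sub_eq_add_neg, Real.exp_add, Real.exp_nat_mul, Real.exp_log (by positivity)]
          simp
  obtain ⟨x, hx, hxl⟩ := exists_mem_lassoBox_lassoMin_eq hxmax.le lam A (A *ᵥ x₀ + z)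
  obtain ⟨s, hs⟩ := exists_gridPoint_near hxmax hN hx
  have hd := abs_lassoObjective_sub_le (abs_gridPoint_le hxmax.le hN s) hx hx₀
    (by positivity) hs hxmax.le lam A z
  set Q := |lam| * n + (∑ i, z i ^ 2 + (1 + 2 * xmax) * (n * ∑ i, ∑ j, A i j ^ 2)) with hQ
  have hlow : -β * (l + 2 * xmax / N * Q) ≤ Λ := by
    rw [hΛ, Real.le_log_iff_exp_le hpos]
    refine le_trans (Real.exp_le_exp.2 ?_) (Finset.single_le_sum
      (f := fun s => Real.exp (-β * H (gridPoint xmax s))) (fun s _ => (Real.exp_pos _).le)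
      (Finset.mem_univ s))
    have := (abs_le.1 hd).2
    rw [hxl] at this
    nlinarith
  have hQ' : |lam| + (1 / n * ∑ i, z i ^ 2 + (1 + 2 * xmax) * ∑ i, ∑ j, A i j ^ 2) = Q / n := by
    rw [hQ]
    field_simp
  have hdiff : lassoCost xmax lam x₀ z A - softLassoCost xmax lam β N x₀ z A =
      (β * l + Λ) / (n * β) := by
    unfold lassoCost softLassoCost
    rw [← hl, ← hH, ← hΛ]
    field_simp
    ring
  have hL0 : 0 ≤ Real.log (N + 1) / β := div_nonneg (Real.log_nonneg (by simp)) hβ.le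
  have hQ0 : 0 ≤ 2 * xmax / N * (Q / n) := by
    have := (abs_nonneg _).trans hd
    rw [← mul_div_assoc]
    positivity
  rw [hQ', hdiff, abs_le]
  constructor
  · have : -(2 * xmax / N * (Q / n)) ≤ (β * l + Λ) / (n * β) := by
      rw [le_div_iff₀ (by positivity)]
      calc -(2 * xmax / N * (Q / n)) * (n * β) = -β * (2 * xmax / N * Q) := by field_simp
        _ ≤ β * l + Λ := by linarith
    linarith
  · have : (β * l + Λ) / (n * β) ≤ Real.log (N + 1) / β := by
      rw [div_le_div_iff₀ (by positivity) hβ]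
      nlinarith
    linarith

theorem abs_lassoCost_le (hxmax : 0 ≤ xmax) (lam : ℝ) {x₀ : Fin n → ℝ}
    (hx₀ : ∀ j, |x₀ j| ≤ xmax) (z : Fin m → ℝ) (A : Matrix (Fin m) (Fin n) ℝ) :
    |lassoCost xmax lam x₀ z A| ≤ 1 / n * (|lam| * (n * xmax) +
      (∑ i, z i ^ 2 + 4 * xmax ^ 2 * (n * ∑ i, ∑ j, A i j ^ 2))) := by
  obtain ⟨x, hx, hxl⟩ := exists_mem_lassoBox_lassoMin_eq hxmax lam A (A *ᵥ x₀ + z)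
  unfold lassoCost
  rw [abs_mul, abs_of_nonneg (by positivity), ← hxl]
  gcongr
  exact abs_lassoObjective_le hx hx₀ lam A z

end Deterministic

section Cost

variable {m n : ℕ} {xmax : ℝ}

theorem continuous_softLassoCost (xmax lam β : ℝ) (N : ℕ) (x₀ : Fin n → ℝ) (c : ℝ) :
    Continuous fun q : (Fin m × Fin n → ℝ) × (Fin m → ℝ) =>
      softLassoCost xmax lam β N x₀ q.2 (c • Matrix.of fun i j => q.1 (i, j)) := by
  simp only [softLassoCost_smul]
  refine continuous_const.mul (Continuous.log (by fun_prop) fun _ =>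
    (Finset.sum_pos (fun _ _ => Real.exp_pos _) Finset.univ_nonempty).ne')

theorem tendsto_log_sq_add_one_div_rpow :
    Tendsto (fun n : ℕ => Real.log ((n : ℝ) ^ 2 + 1) / (n : ℝ) ^ (1 / 8 : ℝ)) atTop (𝓝 0) := by
  have hr : Tendsto (fun n : ℕ => (n : ℝ) ^ (1 / 8 : ℝ)) atTop atTop :=
    (tendsto_rpow_atTop (by norm_num)).comp tendsto_natCast_atTop_atTop
  have h1 : Tendsto (fun n : ℕ => Real.log 2 / (n : ℝ) ^ (1 / 8 : ℝ)) atTop (𝓝 0) :=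
    hr.const_div_atTop _
  have h2 : Tendsto (fun n : ℕ => Real.log n / (n : ℝ) ^ (1 / 8 : ℝ)) atTop (𝓝 0) :=
    ((isLittleO_log_rpow_atTop (by norm_num : (0 : ℝ) < 1 / 8)).tendsto_div_nhds_zero).comp
      tendsto_natCast_atTop_atTop
  have h3 := h1.add (h2.const_mul 2)
  simp only [mul_zero, add_zero] at h3
  refine squeeze_zero' (Eventually.of_forall fun n => ?_) ?_ h3
  · exact div_nonneg (Real.log_nonneg (by nlinarith [sq_nonneg (n : ℝ)])) (by positivity)
  · filter_upwards [eventually_ge_atTop 1] with n hn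
    have hn' : (1 : ℝ) ≤ n := by exact_mod_cast hn
    have : Real.log ((n : ℝ) ^ 2 + 1) ≤ Real.log 2 + 2 * Real.log n := by
      rw [← Real.log_rpow (by linarith), ← Real.log_mul (by norm_num) (by positivity)]
      refine Real.log_le_log (by positivity) ?_
      rw [show (2 : ℝ) = ((2 : ℕ) : ℝ) by norm_num, Real.rpow_natCast]
      push_cast
      nlinarith
    calc Real.log ((n : ℝ) ^ 2 + 1) / (n : ℝ) ^ (1 / 8 : ℝ)
        ≤ (Real.log 2 + 2 * Real.log n) / (n : ℝ) ^ (1 / 8 : ℝ) := by gcongr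
      _ = _ := by ring

theorem tendsto_softLassoCost (hxmax : 0 < xmax) (lam : ℝ) {x₀ : Fin n → ℝ}
    (hx₀ : ∀ j, |x₀ j| ≤ xmax) (hn : 0 < n) (z : Fin m → ℝ) (A : Matrix (Fin m) (Fin n) ℝ) :
    Tendsto (fun k : ℕ => softLassoCost xmax lam ((k : ℝ) ^ (1 / 8 : ℝ)) (k ^ 2) x₀ z A) atTop
      (𝓝 (lassoCost xmax lam x₀ z A)) := by
  rw [tendsto_iff_dist_tendsto_zero]
  have hb (Q : ℝ) : Tendsto (fun k : ℕ => Real.log ((k : ℝ) ^ 2 + 1) / (k : ℝ) ^ (1 / 8 : ℝ)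
      + 2 * xmax / (k : ℝ) ^ 2 * Q) atTop (𝓝 0) := by
    have h : Tendsto (fun k : ℕ => (k : ℝ) ^ 2) atTop atTop :=
      (tendsto_pow_atTop two_ne_zero).comp tendsto_natCast_atTop_atTop
    simpa using tendsto_log_sq_add_one_div_rpow.add ((h.const_div_atTop (2 * xmax)).mul_const Q)
  refine squeeze_zero' (Eventually.of_forall fun k => dist_nonneg) ?_
    (hb (|lam| + (1 / n * ∑ i, z i ^ 2 + (1 + 2 * xmax) * ∑ i, ∑ j, A i j ^ 2)))
  filter_upwards [eventually_ge_atTop 1] with k hk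
  have hk' : (0 : ℝ) < k := by exact_mod_cast hk
  have h := abs_lassoCost_sub_softLassoCost_le hxmax lam (β := (k : ℝ) ^ (1 / 8 : ℝ))
    (by positivity) (N := k ^ 2) (by positivity) hn hx₀ z A
  rw [Nat.cast_pow] at h
  rw [dist_comm, Real.dist_eq]
  exact h

theorem measurable_lassoCost (hxmax : 0 < xmax) (lam : ℝ) {x₀ : Fin n → ℝ}
    (hx₀ : ∀ j, |x₀ j| ≤ xmax) (c : ℝ) :
    Measurable fun q : (Fin m × Fin n → ℝ) × (Fin m → ℝ) =>
      lassoCost xmax lam x₀ q.2 (c • Matrix.of fun i j => q.1 (i, j)) := by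
  rcases Nat.eq_zero_or_pos n with rfl | hn
  · simp [lassoCost]
  exact measurable_of_tendsto_metrizable
    (fun k : ℕ => (continuous_softLassoCost xmax lam ((k : ℝ) ^ (1 / 8 : ℝ)) (k ^ 2) x₀ c).measurable)
    (tendsto_pi_nhds.2 fun q => tendsto_softLassoCost hxmax lam hx₀ hn q.2 _)

end Cost

section ProductLaw

variable {m n : ℕ} {xmax K : ℝ}

/-- The law of a matrix with independent entries of laws `ρ p`, and of an independent noise vector
with i.i.d. entries of law `γ`. -/
noncomputable def matrixNoiseLaw (ρ : Fin m × Fin n → Measure ℝ) (γ : Measure ℝ) :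
    Measure ((Fin m × Fin n → ℝ) × (Fin m → ℝ)) :=
  (Measure.pi ρ).prod (Measure.pi fun _ => γ)

variable {ρ : Fin m × Fin n → Measure ℝ} {γ : Measure ℝ} [∀ p, IsProbabilityMeasure (ρ p)]
  [IsProbabilityMeasure γ]

instance : IsProbabilityMeasure (matrixNoiseLaw ρ γ) := by
  unfold matrixNoiseLaw
  infer_instance

theorem integral_pow_noise (i : Fin m) (p : ℕ) :
    ∫ ζ : Fin m → ℝ, ζ i ^ p ∂Measure.pi (fun _ => γ) = ∫ x, x ^ p ∂γ :=
  integral_pi_comp_eval (ρ := fun _ : Fin m => γ) i (φ := fun x => x ^ p) (by fun_prop)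

theorem integrable_pow_noise (hγ : MemLp (fun x : ℝ => x) 4 γ) (i : Fin m) {p : ℕ} (hp : p ≤ 4) :
    Integrable (fun ζ : Fin m → ℝ => ζ i ^ p) (Measure.pi fun _ => γ) :=
  (hγ.comp_measurePreserving
    (measurePreserving_eval (fun _ : Fin m => γ) i)).integrable_pow_of_le_four hp

theorem integrable_noise_sq (hγ : MemLp (fun x : ℝ => x) 4 γ) (i : Fin m) :
    Integrable (fun q => q.2 i ^ 2) (matrixNoiseLaw ρ γ) :=
  (integrable_pow_noise hγ i (by norm_num)).comp_snd _

theorem integral_noise_sq (i : Fin m) :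
    ∫ q, q.2 i ^ 2 ∂matrixNoiseLaw ρ γ = ∫ x, x ^ 2 ∂γ := by
  unfold matrixNoiseLaw
  rw [integral_fun_snd (fun ζ : Fin m → ℝ => ζ i ^ 2), integral_pow_noise]
  simp

theorem integrable_entry_sq (hρ : ∀ p, IsStandardLaw K (ρ p)) (p : Fin m × Fin n) :
    Integrable (fun q => q.1 p ^ 2) (matrixNoiseLaw ρ γ) :=
  ((memLp_eval_pi hρ p).integrable_pow_of_le_four (by norm_num)).comp_fst _

theorem integral_entry_sq (hρ : ∀ p, IsStandardLaw K (ρ p)) (p : Fin m × Fin n) :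
    ∫ q, q.1 p ^ 2 ∂matrixNoiseLaw ρ γ = 1 := by
  unfold matrixNoiseLaw
  rw [integral_fun_fst (fun a : Fin m × Fin n → ℝ => a p ^ 2),
    integral_pi_comp_eval p (φ := fun x => x ^ 2) (by fun_prop), (hρ p).variance]
  simp

theorem sum_smul_of_sq (c : ℝ) (a : Fin m × Fin n → ℝ) :
    ∑ i, ∑ j, (c • Matrix.of fun i j => a (i, j)) i j ^ 2 = c ^ 2 * ∑ p, a p ^ 2 := by
  rw [Fintype.sum_prod_type, Finset.mul_sum]
  refine Finset.sum_congr rfl fun i _ => ?_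
  rw [Finset.mul_sum]
  refine Finset.sum_congr rfl fun j _ => ?_
  simp only [Matrix.smul_apply, Matrix.of_apply, smul_eq_mul]
  ring

theorem integrable_lassoCost_matrixNoiseLaw (hxmax : 0 < xmax) (lam : ℝ) {x₀ : Fin n → ℝ}
    (hx₀ : ∀ j, |x₀ j| ≤ xmax) (c : ℝ) (hρ : ∀ p, IsStandardLaw K (ρ p))
    (hγ : MemLp (fun x : ℝ => x) 4 γ) :
    Integrable (fun q => lassoCost xmax lam x₀ q.2 (c • Matrix.of fun i j => q.1 (i, j)))
      (matrixNoiseLaw ρ γ) := by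
  have hb : Integrable (fun q : (Fin m × Fin n → ℝ) × (Fin m → ℝ) =>
      1 / n * (|lam| * (n * xmax) +
        (∑ i, q.2 i ^ 2 + 4 * xmax ^ 2 * (n * (c ^ 2 * ∑ p, q.1 p ^ 2))))) (matrixNoiseLaw ρ γ) :=
    ((integrable_const _).add ((integrable_finsetSum _ fun i _ => integrable_noise_sq hγ i).add
      ((((integrable_finsetSum _ fun p _ => integrable_entry_sq hρ p).const_mul _).const_mul
        _).const_mul _))).const_mul _
  refine hb.mono' (measurable_lassoCost hxmax lam hx₀ c).aestronglyMeasurable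
    (Eventually.of_forall fun q => ?_)
  rw [← sum_smul_of_sq, Real.norm_eq_abs]
  exact abs_lassoCost_le hxmax.le lam hx₀ q.2 _

theorem integrable_and_abs_integral_lassoCost_sub_le (hxmax : 0 < xmax) (lam : ℝ)
    {x₀ : Fin n → ℝ} (hx₀ : ∀ j, |x₀ j| ≤ xmax) (hρ : ∀ p, IsStandardLaw K (ρ p))
    (hγ : MemLp (fun x : ℝ => x) 4 γ) {β : ℝ} (hβ : 0 < β) {N : ℕ} (hN : 0 < N) (hn : 0 < n) :
    Integrable (fun q => softLassoCost xmax lam β N x₀ q.2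
      ((√(n : ℝ))⁻¹ • Matrix.of fun i j => q.1 (i, j))) (matrixNoiseLaw ρ γ) ∧
    |∫ q, lassoCost xmax lam x₀ q.2 ((√(n : ℝ))⁻¹ • Matrix.of fun i j => q.1 (i, j))
        ∂matrixNoiseLaw ρ γ
      - ∫ q, softLassoCost xmax lam β N x₀ q.2 ((√(n : ℝ))⁻¹ • Matrix.of fun i j => q.1 (i, j))
        ∂matrixNoiseLaw ρ γ| ≤
    Real.log (N + 1) / β +
      2 * xmax / N * (|lam| + ((m / n : ℝ) * ∫ x, x ^ 2 ∂γ + (1 + 2 * xmax) * m)) := by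
  have hn' : (0 : ℝ) < n := by exact_mod_cast hn
  have hc : (√(n : ℝ))⁻¹ ^ 2 = (n : ℝ)⁻¹ := by rw [inv_pow, Real.sq_sqrt hn'.le]
  have hi := integrable_lassoCost_matrixNoiseLaw hxmax lam hx₀ (√(n : ℝ))⁻¹ hρ hγ
  have iz : Integrable (fun q : (Fin m × Fin n → ℝ) × (Fin m → ℝ) => 1 / (n : ℝ) *
      ∑ i, q.2 i ^ 2) (matrixNoiseLaw ρ γ) :=
    (integrable_finsetSum _ fun i _ => integrable_noise_sq hγ i).const_mul _
  have ia : Integrable (fun q : (Fin m × Fin n → ℝ) × (Fin m → ℝ) => (1 + 2 * xmax) *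
      ((n : ℝ)⁻¹ * ∑ p, q.1 p ^ 2)) (matrixNoiseLaw ρ γ) :=
    ((integrable_finsetSum _ fun p _ => integrable_entry_sq hρ p).const_mul _).const_mul _
  have iza := iz.fun_add ia
  have ic := (integrable_const (μ := matrixNoiseLaw ρ γ) |lam|).fun_add iza
  have hb : Integrable (fun q : (Fin m × Fin n → ℝ) × (Fin m → ℝ) => Real.log (N + 1) / β +
      2 * xmax / N * (|lam| + (1 / n * ∑ i, q.2 i ^ 2 +
        (1 + 2 * xmax) * ((n : ℝ)⁻¹ * ∑ p, q.1 p ^ 2)))) (matrixNoiseLaw ρ γ) :=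
    (integrable_const _).add (ic.const_mul _)
  have hle : ∀ q : (Fin m × Fin n → ℝ) × (Fin m → ℝ),
      |lassoCost xmax lam x₀ q.2 ((√(n : ℝ))⁻¹ • Matrix.of fun i j => q.1 (i, j))
        - softLassoCost xmax lam β N x₀ q.2 ((√(n : ℝ))⁻¹ • Matrix.of fun i j => q.1 (i, j))| ≤
      Real.log (N + 1) / β + 2 * xmax / N * (|lam| + (1 / n * ∑ i, q.2 i ^ 2 +
        (1 + 2 * xmax) * ((n : ℝ)⁻¹ * ∑ p, q.1 p ^ 2))) := fun q => by
    rw [← hc, ← sum_smul_of_sq]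
    exact abs_lassoCost_sub_softLassoCost_le hxmax lam hβ hN hn hx₀ q.2 _
  have hd := hb.mono' ((measurable_lassoCost hxmax lam hx₀ (√(n : ℝ))⁻¹).sub
    (continuous_softLassoCost (m := m) xmax lam β N x₀
      (√(n : ℝ))⁻¹).measurable).aestronglyMeasurable (Eventually.of_forall hle)
  have hs : Integrable (fun q => softLassoCost xmax lam β N x₀ q.2
      ((√(n : ℝ))⁻¹ • Matrix.of fun i j => q.1 (i, j))) (matrixNoiseLaw ρ γ) :=
    (hi.sub hd).congr (Eventually.of_forall fun q => by simp)
  refine ⟨hs, ?_⟩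
  rw [← integral_sub hi hs, ← Real.norm_eq_abs]
  refine (norm_integral_le_of_norm_le hb (Eventually.of_forall fun q => ?_)).trans ?_
  · exact hle q
  rw [integral_add (integrable_const _) (ic.const_mul _), integral_const_mul,
    integral_add (integrable_const _) iza, integral_add iz ia, integral_const_mul,
    integral_const_mul, integral_const_mul,
    integral_finsetSum _ fun i _ => integrable_noise_sq hγ i,
    integral_finsetSum _ fun p _ => integrable_entry_sq hρ p]
  simp only [integral_noise_sq, integral_entry_sq hρ]
  simp only [integral_const, probReal_univ, smul_eq_mul, one_mul, Finset.sum_const,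
    Finset.card_univ, Fintype.card_prod, Fintype.card_fin, nsmul_eq_mul, Nat.cast_mul, mul_one]
  refine le_of_eq ?_
  field_simp

end ProductLaw

theorem IsStandardLaw.mono {K K' : ℝ} {μ : Measure ℝ} (hμ : IsStandardLaw K μ) (h : K ≤ K') :
    IsStandardLaw K' μ :=
  { hμ with integral_pow_six_le := hμ.integral_pow_six_le.trans h }

section Universality

variable {m n : ℕ} {xmax K : ℝ}

/-- Universality of the mean soft minimum. -/
theorem abs_integral_softLassoCost_sub_le (hxmax : 0 < xmax) (lam : ℝ) {x₀ : Fin n → ℝ}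
    (hx₀ : ∀ j, |x₀ j| ≤ xmax) {μ ν γ : Measure ℝ} [IsProbabilityMeasure μ]
    [IsProbabilityMeasure ν] [IsProbabilityMeasure γ] (hμ : IsStandardLaw K μ)
    (hν : IsStandardLaw K ν) (hγ : MemLp (fun x : ℝ => x) 4 γ) {β : ℝ} (hβ : 1 ≤ β) {N : ℕ}
    (hN : 0 < N) (hn : 0 < n) :
    |∫ q, softLassoCost xmax lam β N x₀ q.2 ((√(n : ℝ))⁻¹ • Matrix.of fun i j => q.1 (i, j))
        ∂matrixNoiseLaw (fun _ : Fin m × Fin n => μ) γ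
      - ∫ q, softLassoCost xmax lam β N x₀ q.2 ((√(n : ℝ))⁻¹ • Matrix.of fun i j => q.1 (i, j))
        ∂matrixNoiseLaw (fun _ : Fin m × Fin n => ν) γ| ≤
    (m / n : ℝ) * (β ^ 2 / √(n : ℝ) * (12 * (2 * xmax) ^ 3 * ((1 + K) *
      (1 + 8 * (1 + 8 * ∫ x, x ^ 4 ∂γ + 8 * ((7 + K) * (2 * xmax) ^ 4)))
        + 8 * (2 * xmax) ^ 3 * K))) := by
  have hK := hμ.nonneg
  have hβ0 : 0 < β := by linarith
  have hn' : (1 : ℝ) ≤ n := by exact_mod_cast hn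
  have hs : 1 ≤ √(n : ℝ) := by rwa [Real.one_le_sqrt]
  have hsq : √(n : ℝ) ^ 2 = n := Real.sq_sqrt (by linarith)
  have iμ := (integrable_and_abs_integral_lassoCost_sub_le (m := m) hxmax lam hx₀
    (fun _ => hμ) hγ hβ0 hN hn).1
  have iν := (integrable_and_abs_integral_lassoCost_sub_le (m := m) hxmax lam hx₀
    (fun _ => hν) hγ hβ0 hN hn).1
  unfold matrixNoiseLaw at iμ iν ⊢
  rw [integral_prod_symm _ iμ, integral_prod_symm _ iν,
    ← integral_sub iμ.integral_prod_right iν.integral_prod_right]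
  set V : ℝ := 2 * xmax / √(n : ℝ) with hV
  have hV0 : 0 ≤ V := by positivity
  have hVX : V ≤ 2 * xmax := div_le_self (by positivity) hs
  set W : ℝ := n * (6 * n + (1 + K)) * V ^ 4 with hW
  have hWX : W ≤ (7 + K) * (2 * xmax) ^ 4 := by
    have : W = (6 * n + (1 + K)) / n * (2 * xmax) ^ 4 := by
      rw [hW, hV, div_pow, show √(n : ℝ) ^ 4 = (√(n : ℝ) ^ 2) ^ 2 by ring, hsq]
      field_simp
    rw [this]
    gcongr
    rw [div_le_iff₀ (by linarith)]
    nlinarith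
  have hv : ∀ (s : Fin n → Fin (N + 1)) j,
      |(√(n : ℝ))⁻¹ * (gridPoint xmax s j - x₀ j)| ≤ V := fun s j => by
    rw [abs_mul, abs_of_nonneg (by positivity), hV, inv_mul_eq_div]
    gcongr
    have := abs_gridPoint_le hxmax.le hN s j
    linarith [abs_sub (gridPoint xmax s j) (x₀ j), hx₀ j]
  set b : (Fin m → ℝ) → ℝ := fun ζ => 1 / (n * β) * ∑ p : Fin m × Fin n, 12 * β ^ 3 * V ^ 3 *
    ((1 + K) * (1 + 8 * (1 + 8 * ζ p.1 ^ 4 + 8 * W)) + 8 * V ^ 3 * K) with hb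
  have i1 : ∀ p : Fin m × Fin n, Integrable (fun ζ : Fin m → ℝ => 1 + 8 * ζ p.1 ^ 4)
      (Measure.pi fun _ => γ) := fun p =>
    (integrable_const _).add ((integrable_pow_noise hγ p.1 le_rfl).const_mul _)
  have i2 := fun p => ((i1 p).fun_add (integrable_const (8 * W))).const_mul 8
  have i3 := fun p => ((integrable_const (μ := Measure.pi fun _ => γ) 1).fun_add (i2 p)).const_mul
    (1 + K)
  have i4 := fun p => ((i3 p).fun_add (integrable_const (8 * V ^ 3 * K))).const_mul
    (12 * β ^ 3 * V ^ 3)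
  have hbi : Integrable b (Measure.pi fun _ => γ) :=
    (integrable_finsetSum _ fun p _ => i4 p).const_mul _
  rw [← Real.norm_eq_abs]
  refine (norm_integral_le_of_norm_le hbi (Eventually.of_forall fun ζ => ?_)).trans ?_
  · simp only [softLassoCost_smul, integral_const_mul, ← mul_sub]
    rw [norm_mul, norm_neg, Real.norm_of_nonneg (by positivity), Real.norm_eq_abs, hb]
    exact mul_le_mul_of_nonneg_left
      (abs_integral_logPartition_sub_le hμ hν _ ζ hβ hv) (by positivity)
  · have hG : 0 ≤ ∫ x, x ^ 4 ∂γ := integral_nonneg fun x => by positivity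
    have hp : ∀ p : Fin m × Fin n, ∫ ζ : Fin m → ℝ, 12 * β ^ 3 * V ^ 3 *
        ((1 + K) * (1 + 8 * (1 + 8 * ζ p.1 ^ 4 + 8 * W)) + 8 * V ^ 3 * K)
          ∂Measure.pi (fun _ => γ) = 12 * β ^ 3 * V ^ 3 *
        ((1 + K) * (1 + 8 * (1 + 8 * ∫ x, x ^ 4 ∂γ + 8 * W)) + 8 * V ^ 3 * K) := fun p => by
      rw [integral_const_mul, integral_add (i3 p) (integrable_const _), integral_const_mul,
        integral_add (integrable_const _) (i2 p), integral_const_mul,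
        integral_add (i1 p) (integrable_const _), integral_add (integrable_const _)
        ((integrable_pow_noise hγ p.1 le_rfl).const_mul _), integral_const_mul, integral_pow_noise]
      simp
    rw [hb, integral_const_mul, integral_finsetSum _ fun p _ => i4 p]
    simp only [hp]
    simp only [Finset.sum_const, Finset.card_univ, Fintype.card_prod, Fintype.card_fin,
      nsmul_eq_mul, Nat.cast_mul]
    set G := ∫ x, x ^ 4 ∂γ
    have hV3 : V ^ 3 = (2 * xmax) ^ 3 / (n * √(n : ℝ)) := by
      rw [hV, div_pow, show √(n : ℝ) ^ 3 = √(n : ℝ) ^ 2 * √(n : ℝ) by ring, hsq]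
    calc 1 / (n * β) * (m * n * (12 * β ^ 3 * V ^ 3 *
          ((1 + K) * (1 + 8 * (1 + 8 * G + 8 * W)) + 8 * V ^ 3 * K)))
        = m * (12 * β ^ 2 * V ^ 3 *
          ((1 + K) * (1 + 8 * (1 + 8 * G + 8 * W)) + 8 * V ^ 3 * K)) := by
          field_simp
      _ ≤ m * (12 * β ^ 2 * V ^ 3 * ((1 + K) *
          (1 + 8 * (1 + 8 * G + 8 * ((7 + K) * (2 * xmax) ^ 4))) + 8 * (2 * xmax) ^ 3 * K)) := by
          gcongr
      _ = _ := by
          rw [hV3]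
          field_simp

theorem abs_integral_lassoCost_sub_le (hxmax : 0 < xmax) (lam : ℝ) {x₀ : Fin n → ℝ}
    (hx₀ : ∀ j, |x₀ j| ≤ xmax) {μ ν γ : Measure ℝ} [IsProbabilityMeasure γ]
    (hμ : IsStandardLaw K μ)
    (hν : IsStandardLaw K ν) (hγ : MemLp (fun x : ℝ => x) 4 γ) (hn : 0 < n) :
    |∫ q, lassoCost xmax lam x₀ q.2 ((√(n : ℝ))⁻¹ • Matrix.of fun i j => q.1 (i, j))
        ∂matrixNoiseLaw (fun _ : Fin m × Fin n => μ) γ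
      - ∫ q, lassoCost xmax lam x₀ q.2 ((√(n : ℝ))⁻¹ • Matrix.of fun i j => q.1 (i, j))
        ∂matrixNoiseLaw (fun _ : Fin m × Fin n => ν) γ| ≤
    2 * (Real.log ((n : ℝ) ^ 2 + 1) / (n : ℝ) ^ (1 / 8 : ℝ) + 2 * xmax *
      (|lam| * ((n : ℝ)⁻¹) ^ 2 + ((m / n : ℝ) * (∫ x, x ^ 2 ∂γ) * ((n : ℝ)⁻¹) ^ 2 +
        (1 + 2 * xmax) * ((m / n : ℝ) * (n : ℝ)⁻¹)))) +
    (m / n : ℝ) * ((n : ℝ) ^ (-(1 / 4) : ℝ) * (12 * (2 * xmax) ^ 3 * ((1 + K) *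
      (1 + 8 * (1 + 8 * ∫ x, x ^ 4 ∂γ + 8 * ((7 + K) * (2 * xmax) ^ 4)))
        + 8 * (2 * xmax) ^ 3 * K))) := by
  have := hμ.isProbabilityMeasure
  have := hν.isProbabilityMeasure
  have hn' : (1 : ℝ) ≤ n := by exact_mod_cast hn
  have hβ : 1 ≤ (n : ℝ) ^ (1 / 8 : ℝ) := Real.one_le_rpow hn' (by norm_num)
  have hN : 0 < n ^ 2 := by positivity
  have h1 := (integrable_and_abs_integral_lassoCost_sub_le (m := m) hxmax lam hx₀ (fun _ => hμ) hγ
    (zero_lt_one.trans_le hβ) hN hn).2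
  have h2 := (integrable_and_abs_integral_lassoCost_sub_le (m := m) hxmax lam hx₀ (fun _ => hν) hγ
    (zero_lt_one.trans_le hβ) hN hn).2
  have h3 := abs_integral_softLassoCost_sub_le (m := m) hxmax lam hx₀ hμ hν hγ hβ hN hn
  have e1 : ((n : ℝ) ^ (1 / 8 : ℝ)) ^ 2 / √(n : ℝ) = (n : ℝ) ^ (-(1 / 4) : ℝ) := by
    rw [← Real.rpow_natCast, ← Real.rpow_mul (by linarith), Real.sqrt_eq_rpow,
      ← Real.rpow_sub (by linarith)]
    norm_num
  have e2 : 2 * xmax / ((n ^ 2 : ℕ) : ℝ) *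
      (|lam| + ((m / n : ℝ) * ∫ x, x ^ 2 ∂γ + (1 + 2 * xmax) * m)) = 2 * xmax *
      (|lam| * ((n : ℝ)⁻¹) ^ 2 + ((m / n : ℝ) * (∫ x, x ^ 2 ∂γ) * ((n : ℝ)⁻¹) ^ 2 +
        (1 + 2 * xmax) * ((m / n : ℝ) * (n : ℝ)⁻¹))) := by
    push_cast
    field_simp
  rw [e1] at h3
  rw [e2, Nat.cast_pow] at h1 h2
  rw [abs_le] at h1 h2 h3 ⊢
  constructor <;> linarith [h1.1, h1.2, h2.1, h2.2, h3.1, h3.2]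

end Universality

section JointLaw

variable {Ω : ℕ → Type*} [∀ k, MeasurableSpace (Ω k)] {P : ∀ k, Measure (Ω k)} {m n : ℕ → ℕ}
  {A : ∀ k, Ω k → Matrix (Fin (m k)) (Fin (n k)) ℝ} {σ : ℝ≥0}
  {z : ∀ k, Ω k → Fin (m k) → ℝ}

theorem measurable_matrix_noise (hA : IsStandardType P A) (hz : IsGaussianNoise P σ A z) (k : ℕ) :
    Measurable fun ω => ((fun p : Fin (m k) × Fin (n k) => A k ω p.1 p.2), z k ω) :=
  (measurable_pi_lambda (fun ω (p : Fin (m k) × Fin (n k)) => A k ω p.1 p.2)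
    fun p => hA.measurable k p.1 p.2).prodMk (measurable_pi_lambda _ fun i => hz.measurable k i)

variable [∀ k, IsProbabilityMeasure (P k)]

theorem IsStandardType.exists_isStandardLaw (hA : IsStandardType P A) :
    ∃ K, ∀ k i j, IsStandardLaw K ((P k).map fun ω => A k ω i j) := by
  obtain ⟨K, hK⟩ := hA.sixth_moment
  refine ⟨K, fun k i j => ?_⟩
  have hm := (hA.measurable k i j).aemeasurable (μ := P k)
  refine ⟨Measure.isProbabilityMeasure_map hm, ?_, ?_, ?_, ?_⟩
  · rw [integral_map hm (by fun_prop), hA.mean]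
  · rw [integral_map hm (by fun_prop), hA.variance]
  · exact (integrable_map_measure (by fun_prop) hm).2 (hK k i j).1
  · rw [integral_map hm (by fun_prop)]
    exact (hK k i j).2

theorem map_matrix_noise_eq (hA : IsStandardType P A) (hz : IsGaussianNoise P σ A z) (k : ℕ) :
    (P k).map (fun ω => ((fun p : Fin (m k) × Fin (n k) => A k ω p.1 p.2), z k ω)) =
      matrixNoiseLaw (fun p => (P k).map fun ω => A k ω p.1 p.2) (gaussianReal 0 (σ ^ 2)) := by
  have hmA : Measurable fun ω (p : Fin (m k) × Fin (n k)) => A k ω p.1 p.2 :=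
    measurable_pi_lambda _ fun p => hA.measurable k p.1 p.2
  have hmz : Measurable (z k) := measurable_pi_lambda _ fun i => hz.measurable k i
  have eA := (hA.indep k).map_fun_eq_pi_map fun (p : Fin (m k) × Fin (n k)) =>
    (hA.measurable k p.1 p.2).aemeasurable
  have ez : (P k).map (z k) = _ :=
    (hz.indep k).map_fun_eq_pi_map fun i => (hz.measurable k i).aemeasurable
  refine ((indepFun_iff_map_prod_eq_prod_map_map hmA.aemeasurable hmz.aemeasurable).1
    (hz.indep_matrix k)).trans ?_
  rw [ez]
  simp only [matrixNoiseLaw, (hz.law k _).map_eq]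
  exact congrArg (fun ρ => Measure.prod ρ _) eA

theorem memLp_four_gaussianReal (v : ℝ≥0) : MemLp (fun x : ℝ => x) 4 (gaussianReal 0 v) :=
  memLp_id_gaussianReal' 4 (by norm_num)

theorem integrable_and_integral_lassoCost_eq {xmax : ℝ} (hxmax : 0 < xmax) (lam : ℝ)
    (hA : IsStandardType P A) (hz : IsGaussianNoise P σ A z) (k : ℕ) {x₀ : Fin (n k) → ℝ}
    (hx₀ : ∀ j, |x₀ j| ≤ xmax) (c : ℝ) :
    Integrable (fun ω => lassoCost xmax lam x₀ (z k ω) (c • A k ω)) (P k) ∧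
    ∫ ω, lassoCost xmax lam x₀ (z k ω) (c • A k ω) ∂P k =
      ∫ q, lassoCost xmax lam x₀ q.2 (c • Matrix.of fun i j => q.1 (i, j))
        ∂matrixNoiseLaw (fun p => (P k).map fun ω => A k ω p.1 p.2) (gaussianReal 0 (σ ^ 2)) := by
  obtain ⟨K, hK⟩ := hA.exists_isStandardLaw
  have : ∀ p : Fin (m k) × Fin (n k), IsProbabilityMeasure ((P k).map fun ω => A k ω p.1 p.2) :=
    fun p => (hK k p.1 p.2).isProbabilityMeasure
  have hi := integrable_lassoCost_matrixNoiseLaw hxmax lam hx₀ c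
    (fun p : Fin (m k) × Fin (n k) => hK k p.1 p.2) (memLp_four_gaussianReal (σ ^ 2))
  have hm := (measurable_matrix_noise hA hz k).aemeasurable (μ := P k)
  rw [← map_matrix_noise_eq hA hz k] at hi ⊢
  exact ⟨(integrable_map_measure hi.1 hm).1 hi, (integral_map hm hi.1).symm⟩

end JointLaw

theorem theorem5
    (α xmax lam : ℝ) (σ : ℝ≥0) (hα : 0 < α) (hxmax : 0 < xmax)
    (m n : ℕ → ℕ) (hn : Tendsto n atTop atTop)
    (hmn : Tendsto (fun k => (m k : ℝ) / (n k : ℝ)) atTop (𝓝 α))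
    (x₀ : ∀ k, Fin (n k) → ℝ) (hx₀ : ∀ k j, |x₀ k j| ≤ xmax)
    {Ω : ℕ → Type*} [∀ k, MeasurableSpace (Ω k)]
    (P : ∀ k, Measure (Ω k)) [∀ k, IsProbabilityMeasure (P k)]
    (A : ∀ k, Ω k → Matrix (Fin (m k)) (Fin (n k)) ℝ) (hA : IsStandardType P A)
    (z : ∀ k, Ω k → Fin (m k) → ℝ) (hz : IsGaussianNoise P σ A z)
    {Ω' : ℕ → Type*} [∀ k, MeasurableSpace (Ω' k)]
    (P' : ∀ k, Measure (Ω' k)) [∀ k, IsProbabilityMeasure (P' k)]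
    (B : ∀ k, Ω' k → Matrix (Fin (m k)) (Fin (n k)) ℝ) (hB : IsStandardType P' B)
    (z' : ∀ k, Ω' k → Fin (m k) → ℝ) (hz' : IsGaussianNoise P' σ B z') :
    (∀ k, Integrable
      (fun ω => lassoCost xmax lam (x₀ k) (z k ω) ((√(n k : ℝ))⁻¹ • A k ω)) (P k)) ∧
    (∀ k, Integrable
      (fun ω => lassoCost xmax lam (x₀ k) (z' k ω) ((√(n k : ℝ))⁻¹ • B k ω)) (P' k)) ∧
    Tendsto (fun k =>
      (∫ ω, lassoCost xmax lam (x₀ k) (z k ω) ((√(n k : ℝ))⁻¹ • A k ω) ∂(P k)) -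
      ∫ ω, lassoCost xmax lam (x₀ k) (z' k ω) ((√(n k : ℝ))⁻¹ • B k ω) ∂(P' k))
      atTop (𝓝 0) := by
  refine ⟨fun k => (integrable_and_integral_lassoCost_eq hxmax lam hA hz k (hx₀ k) _).1,
    fun k => (integrable_and_integral_lassoCost_eq hxmax lam hB hz' k (hx₀ k) _).1, ?_⟩
  obtain ⟨K, hK⟩ := hA.exists_isStandardLaw
  obtain ⟨K', hK'⟩ := hB.exists_isStandardLaw
  set γ := gaussianReal 0 (σ ^ 2)
  set C := 12 * (2 * xmax) ^ 3 * ((1 + max K K') *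
      (1 + 8 * (1 + 8 * ∫ x, x ^ 4 ∂γ + 8 * ((7 + max K K') * (2 * xmax) ^ 4)))
        + 8 * (2 * xmax) ^ 3 * max K K') with hC
  have hnr : Tendsto (fun k => (n k : ℝ)) atTop atTop := tendsto_natCast_atTop_atTop.comp hn
  have hinv : Tendsto (fun k => ((n k : ℝ))⁻¹) atTop (𝓝 0) := tendsto_inv_atTop_zero.comp hnr
  have hinv2 : Tendsto (fun k => ((n k : ℝ)⁻¹) ^ 2) atTop (𝓝 0) := by simpa using hinv.pow 2
  have hrpow : Tendsto (fun k => (n k : ℝ) ^ (-(1 / 4) : ℝ)) atTop (𝓝 0) :=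
    (tendsto_rpow_neg_atTop (by norm_num)).comp hnr
  have hlim : Tendsto (fun k => 2 * (Real.log ((n k : ℝ) ^ 2 + 1) / (n k : ℝ) ^ (1 / 8 : ℝ) +
      2 * xmax * (|lam| * ((n k : ℝ)⁻¹) ^ 2 +
        ((m k / n k : ℝ) * (∫ x, x ^ 2 ∂γ) * ((n k : ℝ)⁻¹) ^ 2 +
        (1 + 2 * xmax) * ((m k / n k : ℝ) * (n k : ℝ)⁻¹)))) +
      (m k / n k : ℝ) * ((n k : ℝ) ^ (-(1 / 4) : ℝ) * C)) atTop (𝓝 0) := by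
    have := (((tendsto_log_sq_add_one_div_rpow.comp hn).add
      (((hinv2.const_mul |lam|).add (((hmn.mul_const (∫ x, x ^ 2 ∂γ)).mul hinv2).add
        ((hmn.mul hinv).const_mul (1 + 2 * xmax)))).const_mul (2 * xmax))).const_mul 2).add
      (hmn.mul (hrpow.mul_const C))
    simpa using this
  refine squeeze_zero_norm' ?_ hlim
  filter_upwards [hn.eventually_gt_atTop 0, hmn.eventually_const_lt hα] with k hnk hmk
  have hmk' : 0 < m k := by
    rcases Nat.eq_zero_or_pos (m k) with h | h
    · simp [h] at hmk
    · exact h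
  have hAl : (fun p : Fin (m k) × Fin (n k) => (P k).map fun ω => A k ω p.1 p.2) =
      fun _ => (P k).map fun ω => A k ω ⟨0, hmk'⟩ ⟨0, hnk⟩ :=
    funext fun p => (hA.identDistrib k p.1 p.2 _ _).map_eq
  have hBl : (fun p : Fin (m k) × Fin (n k) => (P' k).map fun ω => B k ω p.1 p.2) =
      fun _ => (P' k).map fun ω => B k ω ⟨0, hmk'⟩ ⟨0, hnk⟩ :=
    funext fun p => (hB.identDistrib k p.1 p.2 _ _).map_eq
  rw [(integrable_and_integral_lassoCost_eq hxmax lam hA hz k (hx₀ k) _).2,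
    (integrable_and_integral_lassoCost_eq hxmax lam hB hz' k (hx₀ k) _).2, hAl, hBl]
  exact abs_integral_lassoCost_sub_le hxmax lam (hx₀ k) ((hK k _ _).mono (le_max_left _ _))
    ((hK' k _ _).mono (le_max_right _ _)) (memLp_four_gaussianReal (σ ^ 2)) hnk
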